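/- Let $d\in\{2,3\}$. For a bounded connected open set $\Omega\subset\mathbb R^d$ let $(\cdot,\cdot)$, $\|\cdot\|$ be the $L^2(\Omega)$ inner product and norm, $X=H^1_0(\Omega)^d$, $Q=\{q\in L^2(\Omega):\int_\Omega q\,dx=0\}$, $V=\{v\in X:(\nabla\cdot v,q)=0\ \forall q\in Q\}$, and $$b^*(v,w,z)=(v\cdot\nabla w,z)+\tfrac12((\nabla\cdot v)w,z),\qquad v,w,z\in X .$$ For $f\in H^{-1}(\Omega)^d=X'$ put $\|f\|_{-1}=\sup_{0\ne v\in X}|\langle f,v\rangle|/\|\nabla v\|$. *AAPicard-Newton iteration with depth $m=1$.* Let $\nu>0$, $u_0\in V$ and damping factors $0<\beta_k\le1$ ($k\ge1$) be given. For $k\ge1$: 1. $\tilde u_k\in V$ satisfies $\nu(\nabla\tilde u_k,\nabla v)+b^*(u_{k-1},\tilde u_k,v)=\langle f,v\rangle$ for all $v\in V$. 2. $\hat u_1=\beta_1\tilde u_1+(1-\beta_1)u_0$ (for instance $\beta_1=1$, $\hat u_1=\tilde u_1$), and for $k\ge2$ $$\hat u_k=\beta_k\big((1-\alpha_k)\tilde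 u_k+\alpha_k\tilde u_{k-1}\big)+(1-\beta_k)\big((1-\alpha_k)u_{k-1}+\alpha_ku_{k-2}\big),$$ where $a=\alpha_k$ minimizes $\|(1-a)\nabla(\tilde u_k-u_{k-1})+a\nabla(\tilde u_{k-1}-u_{k-2})\|$ over $a\in\mathbb R$. 3. $u_k\in V$ satisfies $\nu(\nabla u_k,\nabla v)+b^*(\hat u_k,u_k,v)+b^*(u_k,\hat u_k,v)-b^*(\hat u_k,\hat u_k,v)=\langle f,v\rangle$ for all $v\in V$. For $k\ge2$ let $\theta_k$ be the Anderson gain $$\theta_k=\frac{\|(1-\alpha_k)\nabla(\tilde u_k-u_{k-1})+\alpha_k\nabla(\tilde u_{k-1}-u_{k-2})\|}{\|\nabla(\tilde u_k-u_{k-1})\|}$$ (with $\theta_k=0$ if the denominator vanishes), and let $r_k=\|\nabla(\tilde u_k-\hat u_{k-1})\|$ be the residual. **Theorem.** For every bounded connected open $\Omega$ there is $M>0$, depending only on $\Omega$, such that $$b^*(v,w,z)\le M\|\nabla v\|\,\|\nabla w\|\,\|\nabla z\|\qquad\forall v,w,z\in X. \tag{1}$$ Let $M>0$ satisfy (1),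 put $\sigma=M\nu^{-2}\|f\|_{-1}$, and let $C_A,L>0$ be constants such that $|1-\alpha_k|+|\alpha_k|\le C_A$ for all $k\ge2$, $\|\nabla u_k\|\le L\nu^{-1}\|f\|_{-1}$ for all $k\ge0$, $\sigma<1$ and $\sigma C_A\max\{1,L\}<1$. Then there are constants $C_k>0$ ($k\ge1$) with $$r_{k+1}=C_k\|\nabla(u_k-\hat u_k)\|,\qquad \frac1{2+4\sigma^2L^2}\le C_k^2\le\frac1{1-\sigma C_A\max\{1,L\}},$$ such that for every $k\ge3$ with $\alpha_k\ne0$ $$r_{k+1}\le\frac{\nu^{-1}MC_{k-1}^{-2}C_k}{1-\sigma}\big(\theta_k\beta_k\sigma+(1-\beta_k)C_A\big)r_k^2+(1-\beta_k)\frac{C_A\nu^{-1}MC_{k-2}^{-2}C_k}{1-\sigma}r_{k-1}^2+H_k,$$ where $H_k$ consists of higher-order terms in $r_2,\dots,r_k$ and $\|\nabla(u_1-u_0)\|$: $$H_k=K_k\Big(r_k^4+\sum_{j=2}^{k-1}r_j^{2^{k-j+1}}+\|\nabla(u_1-u_0)\|^{2^{k-1}}\Big),$$ with $K_k$ depending only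 on $k,d,\nu,M,\sigma,C_A,L$ (and not otherwise on $\Omega$, $f$ or the iterates). In particular, if $\beta_k=1$, then the coefficient of the quadratic term is proportional to the Anderson gain: $$r_{k+1}\le\frac{\nu^{-1}MC_{k-1}^{-2}C_k}{1-\sigma}\,\sigma\,\theta_k\,r_k^2+H_k .$$ -/

import Mathlib

open MeasureTheory

noncomputable section

namespace SteadyNSE

/-- Vectors of `ℝᵈ` with the Euclidean norm. -/
abbrev Vec (d : ℕ) := EuclideanSpace ℝ (Fin d)

/-- `d × d` arrays with the Frobenius norm; the entry `(i, j)` of a gradient is `∂ⱼ uᵢ`. -/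
abbrev Mat (d : ℕ) := EuclideanSpace ℝ (Fin d × Fin d)

/-- `L²(Ω; ℝᵈ)`. -/
abbrev L2Vec {d : ℕ} (Ω : Set (Vec d)) := Lp (Vec d) 2 (volume.restrict Ω)

/-- `L²(Ω; ℝᵈˣᵈ)`. -/
abbrev L2Mat {d : ℕ} (Ω : Set (Vec d)) := Lp (Mat d) 2 (volume.restrict Ω)

/-- Bounded, open, connected (and nonempty) sets. -/
structure IsFlowDomain {d : ℕ} (Ω : Set (Vec d)) : Prop where
  isOpen : IsOpen Ω
  isConnected : IsConnected Ω
  isBounded : Bornology.IsBounded Ω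

/-- Smooth vector fields with compact support in `Ω`. -/
structure IsTestField {d : ℕ} (Ω : Set (Vec d)) (φ : Vec d → Vec d) : Prop where
  smooth : ContDiff ℝ (⊤ : ℕ∞) φ
  compact : HasCompactSupport φ
  support : tsupport φ ⊆ Ω

/-- The classical gradient of a vector field: `(gradField φ x) (i, j) = ∂ⱼ φᵢ (x)`. -/
def gradField {d : ℕ} (φ : Vec d → Vec d) (x : Vec d) : Mat d :=
  WithLp.toLp 2 fun p => (fderiv ℝ φ x (EuclideanSpace.single p.2 1)) p.1

/-- The pairs `(φ, ∇φ)`, as elements of `L² × L²`, of the test fields `φ`. -/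
def testGraph {d : ℕ} (Ω : Set (Vec d)) : Submodule ℝ (L2Vec Ω × L2Mat Ω) where
  carrier := {p | ∃ φ : Vec d → Vec d, IsTestField Ω φ ∧
    (p.1 =ᵐ[volume.restrict Ω] φ) ∧ (p.2 =ᵐ[volume.restrict Ω] gradField φ)}
  zero_mem' := by
    refine ⟨0, ⟨contDiff_const, HasCompactSupport.zero, by simp [tsupport]⟩, Lp.coeFn_zero _ _ _, ?_⟩
    filter_upwards [Lp.coeFn_zero (Mat d) 2 (volume.restrict Ω)] with x hx
    have h0 : ((0 : L2Vec Ω × L2Mat Ω).2 : Vec d → Mat d) x = 0 := hx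
    rw [h0]
    ext p
    simp [gradField]
  add_mem' := by
    rintro p q ⟨φ, hφ, h1, h2⟩ ⟨ψ, hψ, h3, h4⟩
    refine ⟨φ + ψ, ⟨hφ.smooth.add hψ.smooth, hφ.compact.add hψ.compact,
      (tsupport_add φ ψ).trans (Set.union_subset hφ.support hψ.support)⟩, ?_, ?_⟩
    · filter_upwards [Lp.coeFn_add p.1 q.1, h1, h3] with x hx hx1 hx3
      change ((p.1 + q.1 : L2Vec Ω) : Vec d → Vec d) x = _
      rw [hx, Pi.add_apply, Pi.add_apply, hx1, hx3]
    · filter_upwards [Lp.coeFn_add p.2 q.2, h2, h4] with x hx hx1 hx3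
      change ((p.2 + q.2 : L2Mat Ω) : Vec d → Mat d) x = _
      rw [hx, Pi.add_apply, hx1, hx3]
      have e := fderiv_add (hφ.smooth.differentiable (by simp) x)
        (hψ.smooth.differentiable (by simp) x)
      ext r
      simp [gradField, e]
  smul_mem' := by
    rintro c p ⟨φ, hφ, h1, h2⟩
    refine ⟨c • φ, ⟨hφ.smooth.const_smul c, hφ.compact.mono ?_, ?_⟩, ?_, ?_⟩
    · exact Function.support_const_smul_subset c φ
    · exact (closure_mono (Function.support_const_smul_subset c φ)).trans hφ.support
    · filter_upwards [Lp.coeFn_smul c p.1, h1] with x hx hx1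
      change ((c • p.1 : L2Vec Ω) : Vec d → Vec d) x = _
      rw [hx, Pi.smul_apply, Pi.smul_apply, hx1]
    · filter_upwards [Lp.coeFn_smul c p.2, h2] with x hx hx1
      change ((c • p.2 : L2Mat Ω) : Vec d → Mat d) x = _
      rw [hx, Pi.smul_apply, hx1]
      have e := fderiv_const_smul (hφ.smooth.differentiable (by simp) x) c
      ext r
      simp [gradField, e]

/-- The space `X = H¹₀(Ω)ᵈ`, the closure of the test fields in `H¹(Ω)ᵈ`. An element of `H¹` is
represented by the pair of `L²` functions `(v, ∇v)`, so that convergence in `H¹` is convergence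
in `L² × L²`; the second entry of a limit of pairs `(φₙ, ∇φₙ)` is the weak gradient of the
first. -/
def X {d : ℕ} (Ω : Set (Vec d)) : Submodule ℝ (L2Vec Ω × L2Mat Ω) :=
  (testGraph Ω).topologicalClosure

/-- The function `v ∈ L²(Ω)ᵈ` underlying an element of `X`. -/
def val {d : ℕ} {Ω : Set (Vec d)} (v : X Ω) : L2Vec Ω := v.1.1

/-- The weak gradient `∇v ∈ L²(Ω)ᵈˣᵈ` of an element of `X`. -/
def grad {d : ℕ} {Ω : Set (Vec d)} (v : X Ω) : L2Mat Ω := v.1.2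

/-- `‖∇v‖`, the `L²(Ω)` norm of the gradient. -/
def gradNorm {d : ℕ} {Ω : Set (Vec d)} (v : X Ω) : ℝ := ‖grad v‖

/-- `(∇v, ∇w)`, the `L²(Ω)` inner product of the gradients. -/
def gradInner {d : ℕ} {Ω : Set (Vec d)} (v w : X Ω) : ℝ := inner ℝ (grad v) (grad w)

/-- The trace of a `d × d` array. -/
def traceCLM (d : ℕ) : Mat d →L[ℝ] ℝ := ∑ i : Fin d, EuclideanSpace.proj (i, i)

/-- The divergence `∇ · v ∈ L²(Ω)`. -/
def divergence {d : ℕ} {Ω : Set (Vec d)} (v : X Ω) : Lp ℝ 2 (volume.restrict Ω) :=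
  (traceCLM d).compLp (grad v)

/-- The pressure space `Q`: functions of `L²(Ω)` with zero mean. -/
def Q {d : ℕ} (Ω : Set (Vec d)) : Set (Lp ℝ 2 (volume.restrict Ω)) :=
  {q | ∫ x in Ω, q x = 0}

/-- The divergence-free velocities `V = {v ∈ X : (∇ · v, q) = 0 for all q ∈ Q}`. -/
def V {d : ℕ} (Ω : Set (Vec d)) : Submodule ℝ (X Ω) where
  carrier := {v | ∀ q ∈ Q Ω, inner ℝ (divergence v) q = 0}
  zero_mem' := by
    intro q _
    have e : divergence (0 : X Ω) = 0 := map_zero ((traceCLM d).compLpL 2 (volume.restrict Ω))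
    rw [e, inner_zero_left]
  add_mem' := by
    intro v w hv hw q hq
    have e : divergence (v + w) = divergence v + divergence w :=
      map_add ((traceCLM d).compLpL 2 (volume.restrict Ω)) (grad v) (grad w)
    rw [e, inner_add_left, hv q hq, hw q hq, add_zero]
  smul_mem' := by
    intro c v hv q hq
    have e : divergence (c • v) = c • divergence v :=
      map_smul ((traceCLM d).compLpL 2 (volume.restrict Ω)) c (grad v)
    rw [e, real_inner_smul_left, hv q hq, mul_zero]

/-- The skew-symmetrized nonlinear term `b*(v, w, z) = (v · ∇w, z) + ½ ((∇ · v) w, z)`. -/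
def bstar {d : ℕ} {Ω : Set (Vec d)} (v w z : X Ω) : ℝ :=
  (∫ x in Ω, ∑ i : Fin d, (∑ j : Fin d, val v x j * grad w x (i, j)) * val z x i) +
    1 / 2 * ∫ x in Ω, (∑ j : Fin d, grad v x (j, j)) * ∑ i : Fin d, val w x i * val z x i

/-- `M` is a constant in `b*(v, w, z) ≤ M ‖∇v‖ ‖∇w‖ ‖∇z‖`. -/
def IsTrilinearBound {d : ℕ} (Ω : Set (Vec d)) (M : ℝ) : Prop :=
  ∀ v w z : X Ω, bstar v w z ≤ M * gradNorm v * gradNorm w * gradNorm z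

/-- The norm `‖f‖₋₁ = sup_{v ≠ 0} |⟨f, v⟩| / ‖∇v‖` of `f ∈ H⁻¹(Ω)ᵈ`, the dual space of `X`.
(The quotient is `0` for `v = 0`.) -/
def dualNorm {d : ℕ} {Ω : Set (Vec d)} (f : X Ω →L[ℝ] ℝ) : ℝ :=
  ⨆ v : X Ω, |f v| / gradNorm v

/-- The Anderson combination `(1 - a) (ũ_k - u_{k-1}) + a (ũ_{k-1} - u_{k-2})` of the stage `k`
and stage `k - 1` Picard residuals (for `k ≥ 2`). -/
def andersonComb {d : ℕ} {Ω : Set (Vec d)} (ut u : ℕ → X Ω) (k : ℕ) (a : ℝ) : X Ω :=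
  (1 - a) • (ut k - u (k - 1)) + a • (ut (k - 1) - u (k - 2))

/-- The Anderson gain `θ_k = ‖∇w_k^α‖ / ‖∇(ũ_k - u_{k-1})‖`. -/
def andersonGain {d : ℕ} {Ω : Set (Vec d)} (α : ℕ → ℝ) (ut u : ℕ → X Ω) (k : ℕ) : ℝ :=
  gradNorm (andersonComb ut u k (α k)) / gradNorm (ut k - u (k - 1))

/-- The sequences `ut` (`ũ_k`, `k ≥ 1`), `uh` (`û_k`, `k ≥ 1`), `u` (`u_k`, `k ≥ 0`) are produced
by the AAPicard-Newton iteration of depth one with damping factors `β_k`, `k ≥ 1`, and Anderson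
coefficients `α_k`, `k ≥ 2`. In the first step only one Picard residual is available, so it has
no Anderson coefficient. -/
structure IsAAPicardNewton {d : ℕ} {Ω : Set (Vec d)} (ν : ℝ) (f : X Ω →L[ℝ] ℝ)
    (β α : ℕ → ℝ) (ut uh u : ℕ → X Ω) : Prop where
  damping : ∀ k, 1 ≤ k → 0 < β k ∧ β k ≤ 1
  initial : u 0 ∈ V Ω
  picard_mem : ∀ k, ut (k + 1) ∈ V Ω
  picard : ∀ k, ∀ v ∈ V Ω,
    ν * gradInner (ut (k + 1)) v + bstar (u k) (ut (k + 1)) v = f v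
  anderson_first : uh 1 = β 1 • ut 1 + (1 - β 1) • u 0
  minimizer : ∀ k, 2 ≤ k → ∀ a : ℝ,
    gradNorm (andersonComb ut u k (α k)) ≤ gradNorm (andersonComb ut u k a)
  anderson : ∀ k, 2 ≤ k →
    uh k = β k • ((1 - α k) • ut k + α k • ut (k - 1)) +
      (1 - β k) • ((1 - α k) • u (k - 1) + α k • u (k - 2))
  newton_mem : ∀ k, u (k + 1) ∈ V Ω
  newton : ∀ k, ∀ v ∈ V Ω,
    ν * gradInner (u (k + 1)) v + bstar (uh (k + 1)) (u (k + 1)) v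
      + bstar (u (k + 1)) (uh (k + 1)) v - bstar (uh (k + 1)) (uh (k + 1)) v = f v

/-- The size `‖∇(ũ_j - û_{j-1})‖` of the residual (for `j ≥ 2`). -/
def resid {d : ℕ} {Ω : Set (Vec d)} (ut uh : ℕ → X Ω) (j : ℕ) : ℝ :=
  gradNorm (ut j - uh (j - 1))

/-- The higher order terms at iteration `k ≥ 3`: powers, with exponents at least `4`, of the
residuals `r_2, …, r_k` and of `s = ‖∇(u_1 - u_0)‖`. -/
def higherOrder (r : ℕ → ℝ) (s : ℝ) (k : ℕ) : ℝ :=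
  r k ^ 4 + ∑ j ∈ Finset.Icc 2 (k - 1), r j ^ 2 ^ (k - j + 1) + s ^ 2 ^ (k - 1)

end SteadyNSE

end

open SteadyNSE

/-!
The bound on `b*` is Hölder's inequality for `L⁴ · L² · L⁴`, together with the Sobolev embedding
`‖v‖_{L⁴} ≤ C ‖∇v‖` (`exists_isSobolevBound`), which the Gagliardo-Nirenberg-Sobolev inequality
gives for test fields in dimensions two and three. For test fields the skew-symmetry
`b*(v, w, z) = -b*(v, z, w)` is an integration by parts; it extends to `X` by density
(`bstar_skew`), so that `b*(v, w, w) = 0`.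

For the rest only these two properties of `b*` matter. Write `δ_k = u_k - û_k` for the Newton
correction and `w_k = ũ_k - u_{k-1}` for the Picard residual. The Newton equation says that `u_k`
solves the nonlinear problem up to the defect `b*(δ_k, δ_k, ·)`. Subtracting it from the next Picard
equation shows that `‖∇w_{k+1}‖ ≤ ν⁻¹ M ‖∇δ_k‖²` (`IsPicardStep.norm_sub_le_sq`) and that the
residual `r_{k+1} = ‖∇(w_{k+1} + δ_k)‖` and `‖∇δ_k‖` bound each other (`IsPicardStep.resid_sq_le`,
`IsPicardStep.norm_defect_sq_le`); the constant `C_k` is their ratio.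

It remains to estimate `‖∇δ_k‖` by the two previous corrections. It satisfies a linearized equation
(`error_equation`), whose right-hand side has three kinds of terms. The convection of `û_k` by the
Anderson combination of `w_k` and `w_{k-1}` is proportional to the gain `θ_k`. The defects of the
two previous Newton steps carry the factor `1 - β_k`. The remaining terms contain
`α_k (u_{k-1} - u_{k-2})`. By minimality `|α_k| ‖∇(w_k - w_{k-1})‖ ≤ ‖∇w_k‖`
(`anderson_coeff_mul_norm_le`), and since the Picard map is a contraction with constant `σ`, the
difference `u_{k-1} - u_{k-2}` is controlled by `w_k - w_{k-1}`. These terms are therefore of the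
order of `‖∇w_k‖ (‖∇w_k‖ + ‖∇w_{k-1}‖)`, which is of fourth order in `r_k` and `r_{k-1}`
(`norm_defect_le`).
-/

open scoped NNReal ENNReal

noncomputable section

namespace SteadyNSE

/-! ### The Sobolev embedding of `X` into `L⁴` -/

lemma norm_fderiv_le_norm_gradField {d : ℕ} (φ : Vec d → Vec d) (x : Vec d) :
    ‖fderiv ℝ φ x‖ ≤ ‖gradField φ x‖ := by
  refine ContinuousLinearMap.opNorm_le_bound _ (norm_nonneg _) fun v => ?_
  have hv : v = ∑ j, v j • EuclideanSpace.single j (1 : ℝ) := by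
    simpa using ((EuclideanSpace.basisFun (Fin d) ℝ).sum_repr v).symm
  have hA : ∀ i, (fderiv ℝ φ x v) i = ∑ j, gradField φ x (i, j) * v j := by
    intro i
    conv_lhs => rw [hv, map_sum]
    simp [gradField, mul_comm]
  refine abs_le_of_sq_le_sq' ?_ (by positivity) |>.2
  rw [mul_pow, EuclideanSpace.norm_sq_eq, EuclideanSpace.norm_sq_eq, EuclideanSpace.norm_sq_eq,
    Fintype.sum_prod_type, Finset.sum_mul]
  refine Finset.sum_le_sum fun i _ => ?_
  simp only [Real.norm_eq_abs, sq_abs, hA]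
  exact Finset.sum_mul_sq_le_sq_mul_sq _ _ _

lemma eLpNorm_eq_restrict_of_support_subset {α E : Type*} [MeasurableSpace α] {μ : Measure α}
    [NormedAddCommGroup E] (f : α → E) (p : ℝ≥0∞) {s : Set α} (h : f.support ⊆ s) :
    eLpNorm f p μ = eLpNorm f p (μ.restrict s) :=
  (eLpNorm_restrict_eq_of_support_subset h).symm

lemma eLpNorm_testField_le {d : ℕ} (hd : d = 2 ∨ d = 3) {Ω : Set (Vec d)}
    (hΩ : Bornology.IsBounded Ω) :
    ∃ C : ℝ≥0, ∀ φ : Vec d → Vec d, IsTestField Ω φ →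
      eLpNorm φ 4 (volume.restrict Ω) ≤ C * eLpNorm (gradField φ) 2 (volume.restrict Ω) := by
  -- For `p = 12/7` both `p < d` and `1/p - 1/d ≤ 1/4` hold in dimensions `2` and `3`, and `p ≤ 2`
  -- lets Hölder's inequality on the bounded set `Ω` return to the `L²` norm of the gradient.
  obtain ⟨p, hp⟩ : ∃ p : ℝ≥0, (p : ℝ) = 12 / 7 := ⟨12 / 7, by simp⟩
  have hp2 : (p : ℝ≥0∞) ≤ 2 := by
    have : p ≤ 2 := by rw [← NNReal.coe_le_coe, hp]; norm_num
    exact_mod_cast this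
  have hp1 : 1 ≤ p := by rw [← NNReal.coe_le_coe, hp]; norm_num
  have hpd : p < Module.finrank ℝ (Vec d) := by
    rw [← NNReal.coe_lt_coe, hp, finrank_euclideanSpace_fin]
    rcases hd with rfl | rfl <;> norm_num
  have hpq : ((p⁻¹ : ℝ≥0) : ℝ) - (Module.finrank ℝ (Vec d) : ℝ)⁻¹ ≤ ((4 : ℝ≥0) : ℝ)⁻¹ := by
    rw [NNReal.coe_inv, hp, finrank_euclideanSpace_fin]
    rcases hd with rfl | rfl <;> norm_num
  set D : ℝ≥0∞ := eLpNormLESNormFDerivOfLeConst (Vec d) (volume : Measure (Vec d)) Ω p 4 *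
    volume Ω ^ (1 / (p : ℝ) - 1 / 2) with hD
  have hDt : D ≠ ∞ := ENNReal.mul_ne_top ENNReal.coe_ne_top
    (ENNReal.rpow_ne_top_of_nonneg (by rw [hp]; norm_num) hΩ.measure_lt_top.ne)
  refine ⟨D.toNNReal, fun φ hφ => ?_⟩
  rw [ENNReal.coe_toNNReal hDt]
  have h1 : eLpNorm φ (4 : ℝ≥0) volume ≤
      eLpNormLESNormFDerivOfLeConst (Vec d) (volume : Measure (Vec d)) Ω p 4 *
        eLpNorm (fderiv ℝ φ) p volume :=
    eLpNorm_le_eLpNorm_fderiv_of_le volume (hφ.smooth.of_le (by simp))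
      ((subset_tsupport φ).trans hφ.support) hp1 hpd hpq hΩ
  have h2 : eLpNorm (fderiv ℝ φ) p volume = eLpNorm (fderiv ℝ φ) p (volume.restrict Ω) :=
    eLpNorm_eq_restrict_of_support_subset _ _ ((support_fderiv_subset ℝ).trans hφ.support)
  have h3 : eLpNorm (fderiv ℝ φ) p (volume.restrict Ω) ≤
      eLpNorm (fderiv ℝ φ) 2 (volume.restrict Ω) * volume Ω ^ (1 / (p : ℝ) - 1 / 2) := by
    have := eLpNorm_le_eLpNorm_mul_rpow_measure_univ (μ := volume.restrict Ω) hp2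
      (f := fderiv ℝ φ) (hφ.smooth.continuous_fderiv (by simp)).aestronglyMeasurable
    simpa using this
  have h4 : eLpNorm (fderiv ℝ φ) 2 (volume.restrict Ω) ≤
      eLpNorm (gradField φ) 2 (volume.restrict Ω) :=
    eLpNorm_mono (norm_fderiv_le_norm_gradField φ)
  calc eLpNorm φ 4 (volume.restrict Ω) ≤ eLpNorm φ 4 volume := eLpNorm_restrict_le _ _ _ _
    _ = eLpNorm φ (4 : ℝ≥0) volume := by norm_num
    _ ≤ _ := h1
    _ ≤ _ := by
        rw [h2, hD, mul_assoc]
        gcongr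
        exact (h3.trans (by gcongr)).trans_eq (mul_comm _ _)

/-- The embedding `H¹₀(Ω)ᵈ ⊂ L⁴(Ω)ᵈ` with constant `C`: `‖v‖_{L⁴} ≤ C ‖∇v‖` for all `v ∈ X`. -/
def IsSobolevBound {d : ℕ} (Ω : Set (Vec d)) (C : ℝ≥0) : Prop :=
  ∀ v : X Ω, eLpNorm (val v) 4 (volume.restrict Ω) ≤ C * eLpNorm (grad v) 2 (volume.restrict Ω)

/-- The embedding passes from test fields to their closure `X`: along a subsequence converging
almost everywhere the `L⁴` norm is lower semicontinuous. -/
lemma exists_isSobolevBound {d : ℕ} (hd : d = 2 ∨ d = 3) {Ω : Set (Vec d)}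
    (hΩ : Bornology.IsBounded Ω) :
    ∃ C : ℝ≥0, IsSobolevBound Ω C := by
  obtain ⟨C, hC⟩ := eLpNorm_testField_le hd hΩ
  refine ⟨C, fun v => ?_⟩
  obtain ⟨p, hp, hpv⟩ := mem_closure_iff_seq_limit.1
    (show v.1 ∈ closure (testGraph Ω : Set (L2Vec Ω × L2Mat Ω)) from v.2)
  have hp1 : Filter.Tendsto (fun n => (p n).1) Filter.atTop (nhds v.1.1) :=
    (continuous_fst.tendsto _).comp hpv
  have hp2 : Filter.Tendsto (fun n => (p n).2) Filter.atTop (nhds v.1.2) :=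
    (continuous_snd.tendsto _).comp hpv
  have hbd : ∀ n, eLpNorm (p n).1 4 (volume.restrict Ω) ≤
      C * eLpNorm (p n).2 2 (volume.restrict Ω) := by
    intro n
    obtain ⟨φ, hφ, h1, h2⟩ := hp n
    rw [eLpNorm_congr_ae h1, eLpNorm_congr_ae h2]
    exact hC φ hφ
  have hn2 : Filter.Tendsto (fun n => eLpNorm (p n).2 2 (volume.restrict Ω)) Filter.atTop
      (nhds (eLpNorm v.1.2 2 (volume.restrict Ω))) := by
    have := (continuous_enorm.tendsto _).comp hp2
    simpa [Function.comp_def, Lp.enorm_def] using this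
  obtain ⟨ns, hns, hae⟩ := (tendstoInMeasure_of_tendsto_Lp hp1).exists_seq_tendsto_ae
  have hlim := Lp.eLpNorm_lim_le_liminf_eLpNorm (p := 4)
    (fun n => Lp.aestronglyMeasurable (p (ns n)).1) v.1.1 hae
  refine hlim.trans ?_
  have ht : Filter.Tendsto (fun n => (C : ℝ≥0∞) * eLpNorm (p (ns n)).2 2 (volume.restrict Ω))
      Filter.atTop (nhds (C * eLpNorm v.1.2 2 (volume.restrict Ω))) :=
    ENNReal.Tendsto.const_mul (hn2.comp hns.tendsto_atTop) (Or.inr ENNReal.coe_ne_top)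
  refine (Filter.liminf_le_liminf (Filter.Eventually.of_forall fun n => hbd (ns n))).trans ?_
  exact ht.liminf_eq.le

/-! ### Integrals of products in `L⁴ · L² · L⁴` -/

section Hoelder

variable {α : Type*} [MeasurableSpace α] {μ : Measure α} {a b c : α → ℝ}

lemma holderTriple_four_four_two : ENNReal.HolderTriple 4 4 2 := ⟨by
    rw [show (4 : ℝ≥0∞) = 2 * 2 by norm_num, ENNReal.mul_inv (by simp) (by simp), ← mul_add,
      ENNReal.inv_two_add_inv_two, mul_one]⟩

lemma memLp_mul_four (ha : MemLp a 4 μ) (hc : MemLp c 4 μ) : MemLp (fun x => a x * c x) 2 μ := by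
  have := holderTriple_four_four_two
  exact hc.mul' ha

lemma integrable_mul_mul (ha : MemLp a 4 μ) (hb : MemLp b 2 μ) (hc : MemLp c 4 μ) :
    Integrable (fun x => a x * b x * c x) μ := by
  refine (hb.integrable_mul (memLp_mul_four ha hc)).congr (Filter.Eventually.of_forall fun x => ?_)
  simp only [Pi.mul_apply]
  ring

lemma abs_integral_mul_mul_le (ha : MemLp a 4 μ) (hb : MemLp b 2 μ) (hc : MemLp c 4 μ) :
    |∫ x, a x * b x * c x ∂μ| ≤
      (eLpNorm a 4 μ).toReal * (eLpNorm b 2 μ).toReal * (eLpNorm c 4 μ).toReal := by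
  have := holderTriple_four_four_two
  have h1 : eLpNorm (a • c) 2 μ ≤ eLpNorm a 4 μ * eLpNorm c 4 μ :=
    eLpNorm_smul_le_mul_eLpNorm hc.1 ha.1
  have h2 : eLpNorm (b • (a • c)) 1 μ ≤ eLpNorm b 2 μ * eLpNorm (a • c) 2 μ :=
    eLpNorm_smul_le_mul_eLpNorm (ha.1.smul hc.1) hb.1
  have h3 : (fun x => a x * b x * c x) = b • (a • c) := by
    ext x
    change a x * b x * c x = b x * (a x * c x)
    ring
  have hi := integrable_mul_mul ha hb hc
  have h4 : |∫ x, a x * b x * c x ∂μ| ≤ (eLpNorm (fun x => a x * b x * c x) 1 μ).toReal := by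
    rw [eLpNorm_one_eq_lintegral_enorm, ← integral_norm_eq_lintegral_enorm hi.1,
      ← Real.norm_eq_abs]
    exact norm_integral_le_integral_norm _
  refine h4.trans ?_
  rw [← ENNReal.toReal_mul, ← ENNReal.toReal_mul, h3]
  refine ENNReal.toReal_mono (ENNReal.mul_ne_top (ENNReal.mul_ne_top ha.2.ne hb.2.ne) hc.2.ne) ?_
  refine h2.trans ((mul_le_mul_right h1 _).trans_eq ?_)
  ring

/-- The integral `∫ a b c dμ`, used with `a, c ∈ L⁴` and `b ∈ L²`; the components of `b*` are of
this form. -/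
def tripleIntegral (μ : Measure α) (a b c : α → ℝ) : ℝ := ∫ x, a x * b x * c x ∂μ

lemma tripleIntegral_left {a₁ a₂ : α → ℝ} {r : ℝ} (h : a =ᵐ[μ] fun x => r * a₁ x + a₂ x)
    (h₁ : MemLp a₁ 4 μ) (h₂ : MemLp a₂ 4 μ) (hb : MemLp b 2 μ) (hc : MemLp c 4 μ) :
    tripleIntegral μ a b c = r * tripleIntegral μ a₁ b c + tripleIntegral μ a₂ b c := by
  unfold tripleIntegral
  rw [← integral_const_mul, ← integral_add ((integrable_mul_mul h₁ hb hc).const_mul r)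
    (integrable_mul_mul h₂ hb hc)]
  refine integral_congr_ae (h.mono fun x hx => ?_)
  simp only [hx]
  ring

lemma tripleIntegral_middle {b₁ b₂ : α → ℝ} {r : ℝ} (h : b =ᵐ[μ] fun x => r * b₁ x + b₂ x)
    (h₁ : MemLp b₁ 2 μ) (h₂ : MemLp b₂ 2 μ) (ha : MemLp a 4 μ) (hc : MemLp c 4 μ) :
    tripleIntegral μ a b c = r * tripleIntegral μ a b₁ c + tripleIntegral μ a b₂ c := by
  unfold tripleIntegral
  rw [← integral_const_mul, ← integral_add ((integrable_mul_mul ha h₁ hc).const_mul r)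
    (integrable_mul_mul ha h₂ hc)]
  refine integral_congr_ae (h.mono fun x hx => ?_)
  simp only [hx]
  ring

lemma tripleIntegral_comm : tripleIntegral μ a b c = tripleIntegral μ c b a := by
  unfold tripleIntegral
  congr 1 with x
  ring

lemma tripleIntegral_right {c₁ c₂ : α → ℝ} {r : ℝ} (h : c =ᵐ[μ] fun x => r * c₁ x + c₂ x)
    (h₁ : MemLp c₁ 4 μ) (h₂ : MemLp c₂ 4 μ) (ha : MemLp a 4 μ) (hb : MemLp b 2 μ) :
    tripleIntegral μ a b c = r * tripleIntegral μ a b c₁ + tripleIntegral μ a b c₂ := by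
  rw [tripleIntegral_comm, tripleIntegral_left h h₁ h₂ hb ha, tripleIntegral_comm (a := c₁),
    tripleIntegral_comm (a := c₂)]

end Hoelder

/-! ### The form `b*` on `X`: bound and trilinearity -/

section Components

variable {d : ℕ} {Ω : Set (Vec d)}

lemma val_combo (r : ℝ) (v w : X Ω) (j : Fin d) :
    (fun x => val (r • v + w) x j) =ᵐ[volume.restrict Ω]
      fun x => r * val v x j + val w x j := by
  filter_upwards [Lp.coeFn_add (r • val v) (val w), Lp.coeFn_smul r (val v)] with x h1 h2
  change ((r • val v + val w : L2Vec Ω) : Vec d → Vec d) x j = _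
  rw [h1, Pi.add_apply, h2]
  simp

lemma grad_combo (r : ℝ) (v w : X Ω) (p : Fin d × Fin d) :
    (fun x => grad (r • v + w) x p) =ᵐ[volume.restrict Ω]
      fun x => r * grad v x p + grad w x p := by
  filter_upwards [Lp.coeFn_add (r • grad v) (grad w), Lp.coeFn_smul r (grad v)] with x h1 h2
  change ((r • grad v + grad w : L2Mat Ω) : Vec d → Mat d) x p = _
  rw [h1, Pi.add_apply, h2]
  simp

lemma memLp_grad_apply (v : X Ω) (p : Fin d × Fin d) :
    MemLp (fun x => grad v x p) 2 (volume.restrict Ω) :=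
  (Lp.memLp (grad v)).continuousLinearMap_comp (EuclideanSpace.proj (𝕜 := ℝ) p)

lemma eLpNorm_grad_apply_le (v : X Ω) (p : Fin d × Fin d) :
    (eLpNorm (fun x => grad v x p) 2 (volume.restrict Ω)).toReal ≤ gradNorm v := by
  rw [gradNorm, Lp.norm_def]
  exact ENNReal.toReal_mono (Lp.eLpNorm_ne_top _)
    (eLpNorm_mono fun x => PiLp.norm_apply_le (grad v x) p)

variable {C : ℝ≥0} (hC : IsSobolevBound Ω C)
include hC

lemma memLp_val (v : X Ω) : MemLp (val v) 4 (volume.restrict Ω) :=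
  ⟨Lp.aestronglyMeasurable _,
    (hC v).trans_lt (ENNReal.mul_lt_top ENNReal.coe_lt_top (Lp.eLpNorm_lt_top _))⟩

lemma memLp_val_apply (v : X Ω) (j : Fin d) :
    MemLp (fun x => val v x j) 4 (volume.restrict Ω) :=
  (memLp_val hC v).continuousLinearMap_comp (EuclideanSpace.proj (𝕜 := ℝ) j)

lemma eLpNorm_val_apply_le (v : X Ω) (j : Fin d) :
    (eLpNorm (fun x => val v x j) 4 (volume.restrict Ω)).toReal ≤ C * gradNorm v := by
  rw [gradNorm, Lp.norm_def, ← ENNReal.coe_toReal, ← ENNReal.toReal_mul]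
  exact ENNReal.toReal_mono (ENNReal.mul_ne_top ENNReal.coe_ne_top (Lp.eLpNorm_ne_top _))
    ((eLpNorm_mono fun x => PiLp.norm_apply_le (val v x) j).trans (hC v))

lemma bstar_eq_sum (v w z : X Ω) : bstar v w z =
    (∑ i, ∑ j, tripleIntegral (volume.restrict Ω) (fun x => val v x j)
      (fun x => grad w x (i, j)) (fun x => val z x i)) +
    1 / 2 * ∑ i, ∑ j, tripleIntegral (volume.restrict Ω) (fun x => val w x i)
      (fun x => grad v x (j, j)) (fun x => val z x i) := by
  have h1 : ∀ i j, Integrable (fun x => val v x j * grad w x (i, j) * val z x i)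
      (volume.restrict Ω) := fun i j => integrable_mul_mul (memLp_val_apply hC v j)
        (memLp_grad_apply w (i, j)) (memLp_val_apply hC z i)
  have h2 : ∀ i j, Integrable (fun x => val w x i * grad v x (j, j) * val z x i)
      (volume.restrict Ω) := fun i j => integrable_mul_mul (memLp_val_apply hC w i)
        (memLp_grad_apply v (j, j)) (memLp_val_apply hC z i)
  unfold bstar tripleIntegral
  congr 1
  · rw [← integral_congr_ae (Filter.Eventually.of_forall fun x => ?_),
      integral_finsetSum _ fun i _ => integrable_finsetSum _ fun j _ => h1 i j]
    · exact Finset.sum_congr rfl fun i _ => integral_finsetSum _ fun j _ => h1 i j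
    · simp only [Finset.sum_mul]
  · congr 1
    rw [← integral_congr_ae (Filter.Eventually.of_forall fun x => ?_),
      integral_finsetSum _ fun i _ => integrable_finsetSum _ fun j _ => h2 i j]
    · exact Finset.sum_congr rfl fun i _ => integral_finsetSum _ fun j _ => h2 i j
    · simp only [Finset.sum_mul_sum]
      rw [Finset.sum_comm]
      refine Finset.sum_congr rfl fun i _ => Finset.sum_congr rfl fun j _ => ?_
      ring

lemma abs_bstar_le (v w z : X Ω) :
    |bstar v w z| ≤ 3 / 2 * d ^ 2 * C ^ 2 * gradNorm v * gradNorm w * gradNorm z := by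
  have key : ∀ (a b c : X Ω) (i j : Fin d) (p : Fin d × Fin d),
      |tripleIntegral (volume.restrict Ω) (fun x => val a x j)
        (fun x => grad b x p) (fun x => val c x i)| ≤
        C * gradNorm a * gradNorm b * (C * gradNorm c) := fun a b c i j p =>
    (abs_integral_mul_mul_le (memLp_val_apply hC a j) (memLp_grad_apply b p)
      (memLp_val_apply hC c i)).trans (by
        have hn : 0 ≤ gradNorm a := norm_nonneg _
        have hn' : 0 ≤ gradNorm b := norm_nonneg _
        gcongr
        · exact eLpNorm_val_apply_le hC a j
        · exact eLpNorm_grad_apply_le b p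
        · exact eLpNorm_val_apply_le hC c i)
  have hs : ∀ (t : Fin d → Fin d → ℝ) (B : ℝ), (∀ i j, |t i j| ≤ B) →
      |∑ i, ∑ j, t i j| ≤ d * (d * B) := by
    intro t B h
    refine (Finset.abs_sum_le_sum_abs _ _).trans ?_
    refine (Finset.sum_le_card_nsmul _ _ (d * B) fun i _ => ?_).trans (by simp)
    refine (Finset.abs_sum_le_sum_abs _ _).trans ?_
    exact (Finset.sum_le_card_nsmul _ _ B fun j _ => h i j).trans (by simp)
  rw [bstar_eq_sum hC]
  refine (abs_add_le _ _).trans ?_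
  rw [abs_mul, abs_of_pos (by norm_num : (0 : ℝ) < 1 / 2)]
  have e1 := hs _ _ fun i j => key v w z i j (i, j)
  have e2 := hs _ _ fun i j => key w v z i i (j, j)
  linarith

lemma bstar_left (r : ℝ) (v v' w z : X Ω) :
    bstar (r • v + v') w z = r * bstar v w z + bstar v' w z := by
  have e1 : ∀ i j, _ := fun i j : Fin d =>
    tripleIntegral_left (val_combo r v v' j) (memLp_val_apply hC v j) (memLp_val_apply hC v' j)
      (memLp_grad_apply w (i, j)) (memLp_val_apply hC z i)
  have e2 : ∀ i j, _ := fun i j : Fin d =>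
    tripleIntegral_middle (grad_combo r v v' (j, j)) (memLp_grad_apply v (j, j))
      (memLp_grad_apply v' (j, j)) (memLp_val_apply hC w i) (memLp_val_apply hC z i)
  simp only [bstar_eq_sum hC, e1, e2, Finset.sum_add_distrib, ← Finset.mul_sum]
  ring

lemma bstar_middle (r : ℝ) (v w w' z : X Ω) :
    bstar v (r • w + w') z = r * bstar v w z + bstar v w' z := by
  have e1 : ∀ i j, _ := fun i j : Fin d =>
    tripleIntegral_middle (grad_combo r w w' (i, j)) (memLp_grad_apply w (i, j))
      (memLp_grad_apply w' (i, j)) (memLp_val_apply hC v j) (memLp_val_apply hC z i)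
  have e2 : ∀ i j, _ := fun i j : Fin d =>
    tripleIntegral_left (val_combo r w w' i) (memLp_val_apply hC w i) (memLp_val_apply hC w' i)
      (memLp_grad_apply v (j, j)) (memLp_val_apply hC z i)
  simp only [bstar_eq_sum hC, e1, e2, Finset.sum_add_distrib, ← Finset.mul_sum]
  ring

lemma bstar_right (r : ℝ) (v w z z' : X Ω) :
    bstar v w (r • z + z') = r * bstar v w z + bstar v w z' := by
  have e1 : ∀ i j, _ := fun i j : Fin d =>
    tripleIntegral_right (val_combo r z z' i) (memLp_val_apply hC z i) (memLp_val_apply hC z' i)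
      (memLp_val_apply hC v j) (memLp_grad_apply w (i, j))
  have e2 : ∀ i j, _ := fun i j : Fin d =>
    tripleIntegral_right (val_combo r z z' i) (memLp_val_apply hC z i) (memLp_val_apply hC z' i)
      (memLp_val_apply hC w i) (memLp_grad_apply v (j, j))
  simp only [bstar_eq_sum hC, e1, e2, Finset.sum_add_distrib, ← Finset.mul_sum]
  ring

end Components

/-! ### Skew-symmetry of `b*` -/

lemma integral_fderiv_apply_eq_zero {d : ℕ} {g : Vec d → ℝ} (hg : ContDiff ℝ 1 g)
    (hc : HasCompactSupport g) (e : Vec d) : ∫ x, fderiv ℝ g x e = 0 := by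
  have hi : Integrable (fun x => fderiv ℝ g x e) volume :=
    ((hg.continuous_fderiv (by simp)).clm_apply continuous_const).integrable_of_hasCompactSupport
      (hc.fderiv_apply ℝ e)
  have := integral_mul_fderiv_eq_neg_fderiv_mul_of_integrable (μ := (volume : Measure (Vec d)))
    (f := fun _ => (1 : ℝ)) (g := g) (v := e) (by simp) (by simpa using hi)
    (by simpa using hg.continuous.integrable_of_hasCompactSupport hc)
    (fun x _ => differentiableAt_const _) (fun x _ => hg.differentiable (by simp) x)
  simpa using this

/-- The integral over `Ω` of the derivative of the product `a b c` along `e` vanishes. -/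
lemma setIntegral_product_rule {d : ℕ} {Ω : Set (Vec d)} {a b c : Vec d → ℝ}
    (ha : ContDiff ℝ 1 a) (hb : ContDiff ℝ 1 b) (hc : ContDiff ℝ 1 c)
    (hac : HasCompactSupport a) (hbc : HasCompactSupport b) (hcc : HasCompactSupport c)
    (haΩ : tsupport a ⊆ Ω) (e : Vec d) :
    (∫ x in Ω, a x * fderiv ℝ b x e * c x) + (∫ x in Ω, a x * fderiv ℝ c x e * b x) +
      ∫ x in Ω, b x * fderiv ℝ a x e * c x = 0 := by
  have hda := (ha.continuous_fderiv (by simp)).clm_apply (continuous_const (y := e))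
  have hdb := (hb.continuous_fderiv (by simp)).clm_apply (continuous_const (y := e))
  have hdc := (hc.continuous_fderiv (by simp)).clm_apply (continuous_const (y := e))
  have i1 : Integrable (fun x => a x * fderiv ℝ b x e * c x) :=
    ((ha.continuous.mul hdb).mul hc.continuous).integrable_of_hasCompactSupport hcc.mul_left
  have i2 : Integrable (fun x => a x * fderiv ℝ c x e * b x) :=
    ((ha.continuous.mul hdc).mul hb.continuous).integrable_of_hasCompactSupport hbc.mul_left
  have i3 : Integrable (fun x => b x * fderiv ℝ a x e * c x) :=
    ((hb.continuous.mul hda).mul hc.continuous).integrable_of_hasCompactSupport hcc.mul_left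
  have i12 : Integrable (fun x => a x * fderiv ℝ b x e * c x + a x * fderiv ℝ c x e * b x) :=
    i1.add i2
  rw [← integral_add i1.integrableOn i2.integrableOn,
    ← integral_add i12.integrableOn i3.integrableOn]
  have habc : ContDiff ℝ 1 (fun x => a x * (b x * c x)) := ha.mul (hb.mul hc)
  have hd : ∀ x, fderiv ℝ (fun x => a x * (b x * c x)) x e =
      a x * fderiv ℝ b x e * c x + a x * fderiv ℝ c x e * b x + b x * fderiv ℝ a x e * c x := by
    intro x
    have da := (ha.differentiable (by simp) x).hasFDerivAt
    have db := (hb.differentiable (by simp) x).hasFDerivAt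
    have dc := (hc.differentiable (by simp) x).hasFDerivAt
    have h : fderiv ℝ (fun x => a x * (b x * c x)) x = _ := (da.mul (db.mul dc)).fderiv
    rw [h]
    simp
    ring
  simp only [← hd]
  rw [setIntegral_eq_integral_of_forall_compl_eq_zero,
    integral_fderiv_apply_eq_zero habc hac.mul_right]
  intro x hx
  have : x ∉ tsupport (fun x => a x * (b x * c x)) := fun h =>
    hx (haΩ (closure_mono (Function.support_mul_subset_left a _) h))
  rw [fderiv_of_notMem_tsupport ℝ this, zero_apply]

lemma gradField_apply {d : ℕ} {φ : Vec d → Vec d} (hφ : ContDiff ℝ 1 φ) (x : Vec d)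
    (i j : Fin d) :
    gradField φ x (i, j) = fderiv ℝ (fun y => φ y i) x (EuclideanSpace.single j 1) := by
  have h := ((EuclideanSpace.proj (𝕜 := ℝ) i : Vec d →L[ℝ] ℝ).hasFDerivAt.comp x
    (hφ.differentiable (by simp) x).hasFDerivAt).fderiv
  have h' : fderiv ℝ (fun y => φ y i) x =
    (EuclideanSpace.proj (𝕜 := ℝ) i : Vec d →L[ℝ] ℝ).comp (fderiv ℝ φ x) := h
  rw [h']
  rfl

lemma IsTestField.contDiff_apply {d : ℕ} {Ω : Set (Vec d)} {φ : Vec d → Vec d}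
    (h : IsTestField Ω φ) (i : Fin d) : ContDiff ℝ 1 (fun x => φ x i) :=
  (EuclideanSpace.proj (𝕜 := ℝ) i : Vec d →L[ℝ] ℝ).contDiff.comp (h.smooth.of_le (by simp))

lemma IsTestField.hasCompactSupport_apply {d : ℕ} {Ω : Set (Vec d)} {φ : Vec d → Vec d}
    (h : IsTestField Ω φ) (i : Fin d) : HasCompactSupport (fun x => φ x i) :=
  h.compact.comp_left (g := fun y : Vec d => y i) rfl

lemma IsTestField.tsupport_apply_subset {d : ℕ} {Ω : Set (Vec d)} {φ : Vec d → Vec d}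
    (h : IsTestField Ω φ) (i : Fin d) : tsupport (fun x => φ x i) ⊆ Ω :=
  (closure_mono (Function.support_comp_subset (g := fun y : Vec d => y i) rfl φ)).trans h.support

/-- The linear map given by a function that preserves the combinations `r • x + y`. -/
def linearMapOfCombo {E F : Type*} [AddCommGroup E] [Module ℝ E] [AddCommGroup F] [Module ℝ F]
    (g : E → F) (h : ∀ (r : ℝ) x y, g (r • x + y) = r • g x + g y) : E →ₗ[ℝ] F where
  toFun := g
  map_add' x y := by simpa using h 1 x y
  map_smul' r x := by
    have h0 : g 0 = 0 := by simpa using h 1 0 0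
    simpa [h0] using h r x 0

section

variable {d : ℕ} {Ω : Set (Vec d)} {C : ℝ≥0} (hC : IsSobolevBound Ω C)

/-- `b*` as a trilinear map. The embedding constant is what makes the integrals converge, hence
`b*` additive. -/
def bstarHom : X Ω →ₗ[ℝ] X Ω →ₗ[ℝ] X Ω →ₗ[ℝ] ℝ :=
  linearMapOfCombo (fun v => linearMapOfCombo (fun w => linearMapOfCombo (bstar v w)
      (fun r z z' => bstar_right hC r v w z z'))
    (fun r w w' => LinearMap.ext fun z => bstar_middle hC r v w w' z))
  (fun r v v' => LinearMap.ext fun w => LinearMap.ext fun z => bstar_left hC r v v' w z)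

lemma gradNorm_le_norm (v : X Ω) : gradNorm v ≤ ‖v‖ := le_max_right _ _

/-- A linear functional bounded by the gradient norm vanishes if it vanishes on the test fields. -/
lemma eq_zero_of_testGraph (ℓ : X Ω →ₗ[ℝ] ℝ) (K : ℝ) (hK : ∀ v, |ℓ v| ≤ K * gradNorm v)
    (h0 : ∀ v : X Ω, v.1 ∈ testGraph Ω → ℓ v = 0) (v : X Ω) : ℓ v = 0 := by
  obtain ⟨p, hp, hpv⟩ := mem_closure_iff_seq_limit.1
    (show v.1 ∈ closure (testGraph Ω : Set (L2Vec Ω × L2Mat Ω)) from v.2)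
  have hq : Filter.Tendsto (fun n => (⟨p n, subset_closure (hp n)⟩ : X Ω)) Filter.atTop (nhds v) :=
    tendsto_subtype_rng.2 hpv
  have hcont : Continuous ℓ := (ℓ.mkContinuous |K| fun v => (hK v).trans
    (mul_le_mul (le_abs_self K) (gradNorm_le_norm v) (norm_nonneg _) (abs_nonneg K))).continuous
  have h1 := (hcont.tendsto v).comp hq
  have h2 : (ℓ ∘ fun n => (⟨p n, subset_closure (hp n)⟩ : X Ω)) = fun _ => 0 :=
    funext fun n => h0 _ (hp n)
  rw [h2] at h1
  exact tendsto_nhds_unique h1 tendsto_const_nhds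

include hC

lemma bstar_skew_test {v w z : X Ω} (hv : v.1 ∈ testGraph Ω) (hw : w.1 ∈ testGraph Ω)
    (hz : z.1 ∈ testGraph Ω) : bstar v w z + bstar v z w = 0 := by
  obtain ⟨φ, hφ, hv1, hv2⟩ := hv
  obtain ⟨ψ, hψ, hw1, hw2⟩ := hw
  obtain ⟨χ, hχ, hz1, hz2⟩ := hz
  have key : ∀ i j : Fin d,
      tripleIntegral (volume.restrict Ω) (fun x => val v x j)
        (fun x => grad w x (i, j)) (fun x => val z x i) +
      tripleIntegral (volume.restrict Ω) (fun x => val v x j)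
        (fun x => grad z x (i, j)) (fun x => val w x i) +
      tripleIntegral (volume.restrict Ω) (fun x => val w x i)
        (fun x => grad v x (j, j)) (fun x => val z x i) = 0 := by
    intro i j
    have h := setIntegral_product_rule (hφ.contDiff_apply j) (hψ.contDiff_apply i)
      (hχ.contDiff_apply i) (hφ.hasCompactSupport_apply j) (hψ.hasCompactSupport_apply i)
      (hχ.hasCompactSupport_apply i) (hφ.tsupport_apply_subset j) (EuclideanSpace.single j 1)
    simp only [← gradField_apply (hφ.smooth.of_le (by simp)),
      ← gradField_apply (hψ.smooth.of_le (by simp)),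
      ← gradField_apply (hχ.smooth.of_le (by simp))] at h
    rw [← h]
    unfold tripleIntegral val grad
    congr 1
    · congr 1
      · refine integral_congr_ae ?_
        filter_upwards [hv1, hw2, hz1] with x h1 h2 h3
        rw [h1, h2, h3]
      · refine integral_congr_ae ?_
        filter_upwards [hv1, hw1, hz2] with x h1 h2 h3
        rw [h1, h2, h3]
    · refine integral_congr_ae ?_
      filter_upwards [hv2, hw1, hz1] with x h1 h2 h3
      rw [h1, h2, h3]
  have hcomm : ∀ i j : Fin d, tripleIntegral (volume.restrict Ω) (fun x => val z x i)
        (fun x => grad v x (j, j)) (fun x => val w x i) =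
      tripleIntegral (volume.restrict Ω) (fun x => val w x i)
        (fun x => grad v x (j, j)) (fun x => val z x i) := fun i j => tripleIntegral_comm
  have hs := Finset.sum_eq_zero fun i (_ : i ∈ Finset.univ) =>
    Finset.sum_eq_zero fun j (_ : j ∈ Finset.univ) => key i j
  simp only [Finset.sum_add_distrib] at hs
  rw [bstar_eq_sum hC, bstar_eq_sum hC]
  simp only [hcomm]
  linarith

lemma bstar_skew (v w z : X Ω) : bstar v w z + bstar v z w = 0 := by
  have hb := abs_bstar_le hC
  set B : ℝ := 3 / 2 * d ^ 2 * C ^ 2 with hB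
  -- The three arguments are released from the test fields one at a time.
  have h1 : ∀ v w z : X Ω, v.1 ∈ testGraph Ω → w.1 ∈ testGraph Ω →
      bstar v w z + bstar v z w = 0 := by
    intro v w z hv hw
    refine eq_zero_of_testGraph (bstarHom hC v w + (bstarHom hC v).flip w)
      (2 * (B * gradNorm v * gradNorm w)) (fun z => ?_)
      (fun z hz => bstar_skew_test hC hv hw hz) z
    exact (abs_add_le _ _).trans ((add_le_add (hb v w z) (hb v z w)).trans_eq (by ring))
  have h2 : ∀ v w z : X Ω, v.1 ∈ testGraph Ω → bstar v w z + bstar v z w = 0 := by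
    intro v w z hv
    refine eq_zero_of_testGraph ((bstarHom hC v).flip z + bstarHom hC v z)
      (2 * (B * gradNorm v * gradNorm z)) (fun w => ?_) (fun w hw => h1 v w z hv hw) w
    exact (abs_add_le _ _).trans ((add_le_add (hb v w z) (hb v z w)).trans_eq (by ring))
  refine eq_zero_of_testGraph (((bstarHom hC).flip w).flip z + ((bstarHom hC).flip z).flip w)
    (2 * (B * gradNorm w * gradNorm z)) (fun v => ?_) (fun v hv => h2 v w z hv) v
  exact (abs_add_le _ _).trans ((add_le_add (hb v w z) (hb v z w)).trans_eq (by ring))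

lemma bstar_self (v w : X Ω) : bstar v w w = 0 := by
  have := bstar_skew hC v w w
  linarith

/-! ### The dual norm -/

/-- Poincaré's inequality, from the embedding into `L⁴`. -/
lemma exists_norm_val_le [IsFiniteMeasure (volume.restrict Ω)] :
    ∃ P : ℝ, 0 ≤ P ∧ ∀ v : X Ω, ‖val v‖ ≤ P * gradNorm v := by
  set D : ℝ≥0∞ := C * (volume.restrict Ω) Set.univ ^ (1 / (2 : ℝ≥0∞).toReal - 1 / (4 : ℝ≥0∞).toReal)
    with hD
  have hDt : D ≠ ∞ := ENNReal.mul_ne_top ENNReal.coe_ne_top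
    (ENNReal.rpow_ne_top_of_nonneg (by norm_num) (measure_ne_top _ _))
  refine ⟨D.toReal, ENNReal.toReal_nonneg, fun v => ?_⟩
  rw [gradNorm, Lp.norm_def, Lp.norm_def, ← ENNReal.toReal_mul]
  refine ENNReal.toReal_mono (ENNReal.mul_ne_top hDt (Lp.eLpNorm_ne_top _)) ?_
  have h24 : (2 : ℝ≥0∞) ≤ 4 := by norm_num
  refine (eLpNorm_le_eLpNorm_mul_rpow_measure_univ h24 (Lp.aestronglyMeasurable (val v))).trans ?_
  refine (mul_le_mul_left (hC v) _).trans_eq ?_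
  rw [hD]
  ring

/-- By Poincaré's inequality the supremum defining `‖f‖₋₁` is over a bounded set. -/
lemma abs_apply_le_dualNorm [IsFiniteMeasure (volume.restrict Ω)] (f : X Ω →L[ℝ] ℝ) (v : X Ω) :
    |f v| ≤ dualNorm f * gradNorm v := by
  obtain ⟨P, hP, hPv⟩ := exists_norm_val_le hC
  have hf : ∀ v, |f v| ≤ ‖f‖ * max P 1 * gradNorm v := by
    intro v
    have hg : 0 ≤ gradNorm v := norm_nonneg _
    have hv : ‖v‖ ≤ max P 1 * gradNorm v := by
      refine max_le ((hPv v).trans ?_) ?_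
      · gcongr
        exact le_max_left _ _
      · exact le_mul_of_one_le_left hg (le_max_right P 1)
    calc |f v| ≤ ‖f‖ * ‖v‖ := f.le_opNorm v
      _ ≤ _ := by rw [mul_assoc]; gcongr
  rcases (norm_nonneg (grad v)).eq_or_lt with h | h
  · have h0 : gradNorm v = 0 := h.symm
    have := hf v
    rw [h0, mul_zero] at this ⊢
    exact this
  · rw [← div_le_iff₀ (show 0 < gradNorm v from h)]
    refine le_ciSup (f := fun v : X Ω => |f v| / gradNorm v) ⟨‖f‖ * max P 1, ?_⟩ v
    rintro _ ⟨w, rfl⟩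
    exact div_le_of_le_mul₀ (norm_nonneg _) (by positivity) (hf w)

end

lemma dualNorm_nonneg {d : ℕ} {Ω : Set (Vec d)} (f : X Ω →L[ℝ] ℝ) : 0 ≤ dualNorm f :=
  Real.iSup_nonneg fun _ => div_nonneg (abs_nonneg _) (norm_nonneg _)

/-! ### Picard and Newton steps in an abstract setting -/

lemma le_of_mul_self_le {a D R : ℝ} (hD : 0 ≤ D) (hR : 0 ≤ R) (h : a * D ^ 2 ≤ R * D) :
    a * D ≤ R := by
  rcases hD.eq_or_lt with rfl | hD
  · simpa using hR
  · exact le_of_mul_le_mul_right (by nlinarith) hD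

/-- The minimal combination of `w` and `w'` is orthogonal to `w - w'`, so `‖w‖²` is the sum of its
squared norm and `a² ‖w - w'‖²`. -/
lemma anderson_coeff_mul_norm_le {H : Type*} [NormedAddCommGroup H] [InnerProductSpace ℝ H]
    {w w' : H} {a : ℝ}
    (hmin : ∀ t : ℝ, ‖(1 - a) • w + a • w'‖ ≤ ‖(1 - t) • w + t • w'‖) :
    |a| * ‖w - w'‖ ≤ ‖w‖ := by
  set e := w - w' with he
  set W := (1 - a) • w + a • w' with hW
  have hw : w = W + a • e := by rw [hW, he]; module
  have hperp : inner ℝ W e = 0 := by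
    by_contra hne
    have he0 : 0 < ‖e‖ ^ 2 := by
      have : e ≠ 0 := fun h => hne (by rw [h, inner_zero_right])
      positivity
    have h1 : ∀ t : ℝ, ‖W‖ ^ 2 ≤ ‖W‖ ^ 2 - 2 * t * inner ℝ W e + t ^ 2 * ‖e‖ ^ 2 := by
      intro t
      have e1 : (1 - (a + t)) • w + (a + t) • w' = W - t • e := by rw [hW, he]; module
      have h2 := pow_le_pow_left₀ (norm_nonneg _) (hmin (a + t)) 2
      rw [e1, norm_sub_sq_real, real_inner_smul_right, norm_smul, mul_pow, Real.norm_eq_abs,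
        sq_abs] at h2
      linarith
    have h2 := h1 (inner ℝ W e / ‖e‖ ^ 2)
    have h3 : (0 : ℝ) < (inner ℝ W e) ^ 2 / ‖e‖ ^ 2 := by positivity
    have h4 : -(2 * (inner ℝ W e / ‖e‖ ^ 2) * inner ℝ W e) + (inner ℝ W e / ‖e‖ ^ 2) ^ 2 * ‖e‖ ^ 2
        = -((inner ℝ W e) ^ 2 / ‖e‖ ^ 2) := by
      field_simp
      ring
    linarith
  refine abs_le_of_sq_le_sq' ?_ (norm_nonneg _) |>.2
  conv_rhs => rw [hw, norm_add_sq_real, real_inner_smul_right, hperp, norm_smul, mul_pow,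
    Real.norm_eq_abs, sq_abs]
  rw [mul_pow, sq_abs]
  nlinarith [sq_nonneg ‖W‖]

section Abstract

variable {E H : Type*} [AddCommGroup E] [Module ℝ E] [NormedAddCommGroup H]
  [InnerProductSpace ℝ H]

/-- `b` is a convection form for the energy norm `‖G ·‖`: it vanishes when its last two arguments
agree, and it is bounded with constant `M`. The map `G` plays the role of the gradient. -/
structure IsConvection (G : E →ₗ[ℝ] H) (b : E →ₗ[ℝ] E →ₗ[ℝ] E →ₗ[ℝ] ℝ) (M : ℝ) : Prop where
  self : ∀ v w, b v w w = 0
  bound : ∀ v w z, |b v w z| ≤ M * ‖G v‖ * ‖G w‖ * ‖G z‖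

/-- `p` is the Picard iterate computed from `u`: it solves the equation linearized by freezing the
transporting field at `u`. -/
def IsPicardStep (ν : ℝ) (G : E →ₗ[ℝ] H) (b : E →ₗ[ℝ] E →ₗ[ℝ] E →ₗ[ℝ] ℝ) (f : E →ₗ[ℝ] ℝ)
    (V : Submodule ℝ E) (u p : E) : Prop :=
  p ∈ V ∧ ∀ v ∈ V, ν * inner ℝ (G p) (G v) + b u p v = f v

/-- `u` solves the nonlinear problem up to the defect `b(δ, δ, ·)`. A Newton step from `û` produces
such a `u` with `δ = u - û`, since `b(û, u) + b(u, û) - b(û, û) = b(u, u) - b(u - û, u - û)`. -/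
def IsSolutionWithDefect (ν : ℝ) (G : E →ₗ[ℝ] H) (b : E →ₗ[ℝ] E →ₗ[ℝ] E →ₗ[ℝ] ℝ)
    (f : E →ₗ[ℝ] ℝ) (V : Submodule ℝ E) (u δ : E) : Prop :=
  u ∈ V ∧ δ ∈ V ∧ ∀ v ∈ V, ν * inner ℝ (G u) (G v) + b u u v - b δ δ v = f v

variable {G : E →ₗ[ℝ] H} {b : E →ₗ[ℝ] E →ₗ[ℝ] E →ₗ[ℝ] ℝ} {M ν F σ : ℝ} {f : E →ₗ[ℝ] ℝ}
  {V : Submodule ℝ E}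

lemma IsConvection.le (h : IsConvection G b M) (v w z : E) :
    b v w z ≤ M * ‖G v‖ * ‖G w‖ * ‖G z‖ := (le_abs_self _).trans (h.bound v w z)

lemma IsConvection.neg_le (h : IsConvection G b M) (v w z : E) :
    -b v w z ≤ M * ‖G v‖ * ‖G w‖ * ‖G z‖ := (neg_le_abs _).trans (h.bound v w z)

lemma IsPicardStep.norm_le (hb : IsConvection G b M) (hν : 0 < ν) (hF : 0 ≤ F)
    (hf : ∀ v, |f v| ≤ F * ‖G v‖) {u p : E} (hp : IsPicardStep ν G b f V u p) :
    ‖G p‖ ≤ ν⁻¹ * F := by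
  have h := hp.2 p hp.1
  rw [hb.self, real_inner_self_eq_norm_sq] at h
  have h1 : ν * ‖G p‖ ≤ F :=
    le_of_mul_self_le (norm_nonneg _) hF (by linarith [le_abs_self (f p), hf p])
  rw [inv_mul_eq_div, le_div_iff₀ hν]
  linarith

/-- The Picard map is a contraction with constant `σ = M ν⁻² F`. -/
lemma IsPicardStep.norm_sub_le (hb : IsConvection G b M) (hν : 0 < ν) (hM : 0 < M) (hF : 0 ≤ F)
    (hf : ∀ v, |f v| ≤ F * ‖G v‖) {x y p q : E} (hp : IsPicardStep ν G b f V x p)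
    (hq : IsPicardStep ν G b f V y q) :
    ‖G (p - q)‖ ≤ M * ν⁻¹ ^ 2 * F * ‖G (x - y)‖ := by
  have hpq := V.sub_mem hp.1 hq.1
  have h1 := hp.2 _ hpq
  have h2 := hq.2 _ hpq
  have hself := hb.self y (p - q)
  have h3 : ν * ‖G (p - q)‖ ^ 2 = -b (x - y) p (p - q) := by
    rw [← real_inner_self_eq_norm_sq]
    simp only [map_sub, LinearMap.sub_apply, inner_sub_left, inner_sub_right] at *
    linear_combination h1 - h2 - hself
  have h4 := hb.neg_le (x - y) p (p - q)
  have h5 := hp.norm_le hb hν hF hf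
  have h6 : ν * ‖G (p - q)‖ ≤ M * ‖G (x - y)‖ * ‖G p‖ :=
    le_of_mul_self_le (norm_nonneg _) (by positivity) (by linarith)
  have h7 : M * ‖G (x - y)‖ * ‖G p‖ ≤ M * ‖G (x - y)‖ * (ν⁻¹ * F) := by gcongr
  have h8 : ‖G (p - q)‖ = ν⁻¹ * (ν * ‖G (p - q)‖) := by field_simp
  rw [h8]
  calc ν⁻¹ * (ν * ‖G (p - q)‖) ≤ ν⁻¹ * (M * ‖G (x - y)‖ * (ν⁻¹ * F)) :=
        mul_le_mul_of_nonneg_left (h6.trans h7) (by positivity)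
    _ = _ := by ring

lemma IsPicardStep.sub_eq {u δ p : E} (hp : IsPicardStep ν G b f V u p)
    (hu : IsSolutionWithDefect ν G b f V u δ) {v : E} (hv : v ∈ V) :
    ν * inner ℝ (G (p - u)) (G v) + b u (p - u) v + b δ δ v = 0 := by
  have h1 := hp.2 v hv
  have h2 := hu.2.2 v hv
  simp only [map_sub, LinearMap.sub_apply, inner_sub_left]
  linear_combination h1 - h2

/-- A Picard step taken after a Newton step moves quadratically little in the Newton correction. -/
lemma IsPicardStep.norm_sub_le_sq (hb : IsConvection G b M) (hν : 0 < ν) (hM : 0 < M)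
    {u δ p : E} (hp : IsPicardStep ν G b f V u p) (hu : IsSolutionWithDefect ν G b f V u δ) :
    ‖G (p - u)‖ ≤ ν⁻¹ * M * ‖G δ‖ ^ 2 := by
  have h := hp.sub_eq hu (V.sub_mem hp.1 hu.1)
  rw [hb.self, real_inner_self_eq_norm_sq] at h
  have h1 := hb.neg_le δ δ (p - u)
  have h2 : ν * ‖G (p - u)‖ ≤ M * ‖G δ‖ ^ 2 :=
    le_of_mul_self_le (norm_nonneg _) (by positivity) (by linarith)
  rw [mul_assoc, inv_mul_eq_div, le_div_iff₀ hν]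
  linarith

/-- The residual is bounded by the Newton correction. With `δ = u - û` and `w = p - u`, testing with
`w + δ` gives `‖w + δ‖² + ‖w‖² = ‖δ‖² + 2 ν⁻¹ b(û, δ, w)`, hence even the factor `1 + s²`. -/
lemma IsPicardStep.resid_sq_le (hb : IsConvection G b M) (hν : 0 < ν) (hM : 0 < M) {s : ℝ}
    (hs : s < 1) {u uh p : E} (hp : IsPicardStep ν G b f V u p)
    (hu : IsSolutionWithDefect ν G b f V u (u - uh)) (hhat : M * ‖G uh‖ ≤ ν * s) :
    ‖G (p - uh)‖ ^ 2 ≤ (1 - s)⁻¹ * ‖G (u - uh)‖ ^ 2 := by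
  obtain ⟨δ, rfl⟩ : ∃ δ, uh = u - δ := ⟨u - uh, (sub_sub_cancel _ _).symm⟩
  rw [sub_sub_cancel] at hu ⊢
  have hρ : p - (u - δ) ∈ V := V.sub_mem hp.1 (V.sub_mem hu.1 hu.2.1)
  have h := hp.sub_eq hu hρ
  set w := p - u with hw
  have hs0 : 0 ≤ s := by
    have : 0 ≤ ν * s := le_trans (by positivity) hhat
    exact nonneg_of_mul_nonneg_right this hν
  have e1 : p - (u - δ) = w + δ := by rw [hw]; abel
  rw [e1] at h ⊢
  have hs1 := hb.self u (w + δ)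
  have hs2 := hb.self u δ
  have hs3 := hb.self δ δ
  have h2 := hb.le (u - δ) δ w
  have h3 : ν * ‖G (w + δ)‖ ^ 2 + ν * ‖G w‖ ^ 2 = ν * ‖G δ‖ ^ 2 + 2 * b (u - δ) δ w := by
    simp only [← real_inner_self_eq_norm_sq]
    simp only [map_add, map_sub, LinearMap.sub_apply, LinearMap.add_apply, inner_add_left,
      inner_add_right] at *
    rw [real_inner_comm (G w) (G δ)] at *
    linear_combination 2 * h - 2 * hs1 + 2 * hs2 - 2 * hs3
  have h4 : M * ‖G (u - δ)‖ * ‖G δ‖ * ‖G w‖ ≤ ν * s * ‖G δ‖ * ‖G w‖ := by gcongr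
  have h5 : ‖G (w + δ)‖ ^ 2 + ‖G w‖ ^ 2 ≤ ‖G δ‖ ^ 2 + 2 * s * ‖G δ‖ * ‖G w‖ :=
    le_of_mul_le_mul_left (by linarith) hν
  have h6 : ‖G (w + δ)‖ ^ 2 ≤ (1 + s ^ 2) * ‖G δ‖ ^ 2 := by
    nlinarith [sq_nonneg (‖G w‖ - s * ‖G δ‖)]
  refine h6.trans ?_
  gcongr
  rw [← one_div, le_div_iff₀ (by linarith)]
  nlinarith [mul_nonneg hs0 (sq_nonneg s), mul_nonneg hs0 (sub_nonneg.2 hs.le)]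

/-- The Newton correction is bounded by the residual; testing with `u - û` gives the factor
`(1 + l)²`. -/
lemma IsPicardStep.norm_defect_sq_le (hb : IsConvection G b M) (hν : 0 < ν) (hM : 0 < M) {l : ℝ}
    {u uh p : E} (hp : IsPicardStep ν G b f V u p)
    (hu : IsSolutionWithDefect ν G b f V u (u - uh)) (hul : M * ‖G u‖ ≤ ν * l) :
    ‖G (u - uh)‖ ^ 2 ≤ (2 + 4 * l ^ 2) * ‖G (p - uh)‖ ^ 2 := by
  obtain ⟨δ, rfl⟩ : ∃ δ, uh = u - δ := ⟨u - uh, (sub_sub_cancel _ _).symm⟩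
  rw [sub_sub_cancel] at hu ⊢
  have h := hp.sub_eq hu hu.2.1
  set ρ := p - (u - δ) with hρ
  have hl0 : 0 ≤ l := by
    have : 0 ≤ ν * l := le_trans (by positivity) hul
    exact nonneg_of_mul_nonneg_right this hν
  have e1 : p - u = ρ - δ := by rw [hρ]; abel
  have hs1 := hb.self u δ
  have hs2 := hb.self δ δ
  rw [e1] at h
  have h1 : ν * ‖G δ‖ ^ 2 = ν * inner ℝ (G ρ) (G δ) + b u ρ δ := by
    simp only [← real_inner_self_eq_norm_sq]
    simp only [map_sub, LinearMap.sub_apply, inner_sub_left] at *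
    linear_combination -h - hs1 + hs2
  have h2 : ν * inner ℝ (G ρ) (G δ) ≤ ν * (‖G ρ‖ * ‖G δ‖) := by
    gcongr
    exact real_inner_le_norm _ _
  have h3 := hb.le u ρ δ
  have h4 : M * ‖G u‖ * ‖G ρ‖ * ‖G δ‖ ≤ ν * l * ‖G ρ‖ * ‖G δ‖ := by gcongr
  have h5 : ν * ‖G δ‖ ≤ ν * ((1 + l) * ‖G ρ‖) :=
    le_of_mul_self_le (norm_nonneg _) (by positivity) (by linarith)
  have h6 := le_of_mul_le_mul_left h5 hν
  calc ‖G δ‖ ^ 2 ≤ ((1 + l) * ‖G ρ‖) ^ 2 := by gcongr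
    _ = (1 + l) ^ 2 * ‖G ρ‖ ^ 2 := by ring
    _ ≤ _ := by
      gcongr
      nlinarith [sq_nonneg (1 - l), sq_nonneg l]

/-- The equation for the Newton correction `δ = z - û`, where `x, y` are the last two iterates,
`w, w'` their Picard residuals, and `û` the damped Anderson combination. It compares the Newton
equation for `z` with the combination of the four equations for `p, q, x, y`, with the weights
that these have in `û`. -/
lemma error_equation {x y z p q δx δy δ w w' : E} {a β : ℝ}
    (hx : IsSolutionWithDefect ν G b f V x δx) (hy : IsSolutionWithDefect ν G b f V y δy)
    (hz : IsSolutionWithDefect ν G b f V z δ)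
    (hp : IsPicardStep ν G b f V x p) (hq : IsPicardStep ν G b f V y q)
    (hw : w = p - x) (hw' : w' = q - y)
    (hzδ : z - δ = β • ((1 - a) • p + a • q) + (1 - β) • ((1 - a) • x + a • y))
    {v : E} (hv : v ∈ V) :
    ν * inner ℝ (G δ) (G v) + b (z - δ) δ v + b δ (z - δ) v =
      a * (1 - a) * b (x - y) (x - y) v + β * (a * (1 - a)) * b (x - y) (w - w') v
        - β * b ((1 - a) • w + a • w') (z - δ) v
        - (1 - β) * ((1 - a) * b δx δx v + a * b δy δy v) := by
  obtain rfl : p = x + w := by rw [hw]; abel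
  obtain rfl : q = y + w' := by rw [hw']; abel
  obtain rfl : z = δ + (β • ((1 - a) • (x + w) + a • (y + w')) +
      (1 - β) • ((1 - a) • x + a • y)) := by rw [← hzδ]; abel
  have h1 := hx.2.2 v hv
  have h2 := hy.2.2 v hv
  have h3 := hz.2.2 v hv
  have h4 := hp.2 v hv
  have h5 := hq.2 v hv
  simp only [map_add, map_sub, map_smul, LinearMap.add_apply, LinearMap.sub_apply,
    LinearMap.smul_apply, smul_eq_mul, inner_add_left, real_inner_smul_left] at *
  linear_combination h3 - (1 - β) * (1 - a) * h1 - (1 - β) * a * h2 - β * (1 - a) * h4 - β * a * h5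

end Abstract

/-! ### The estimate of the Newton correction -/

/-- The constant `τ` for which `m τ ‖w‖ (‖w‖ + ‖w'‖)` bounds the terms of the error equation that
contain differences of iterates; here `m = ν⁻¹ M`, and `w, w'` are the Picard residuals. -/
def crossConst (σ CA : ℝ) : ℝ := CA * (1 - σ)⁻¹ * ((1 - σ)⁻¹ + 1)

/-- The constant `κ` in `‖∇(û - ũ)‖ ≤ κ ‖∇w‖`, where `w` is the Picard residual. -/
def offsetConst (σ : ℝ) : ℝ := 2 + (1 - σ)⁻¹

/-- The constant in the a priori bound `D ≤ κ₂ (A² + B²)` of the Newton correction `D` by the two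
previous ones. -/
def aprioriConst (m σ s CA L : ℝ) : ℝ :=
  (1 - s)⁻¹ * (crossConst σ CA * (2 * ((1 + L) * σ)) * m + s * m + m * CA)

/-- The constant of the fourth order remainder in the estimate of the Newton correction. -/
def remainderConst (m σ s CA L : ℝ) : ℝ :=
  (1 - σ)⁻¹ * (crossConst σ CA * m ^ 3 + offsetConst σ * m ^ 3
    + m ^ 2 * offsetConst σ * aprioriConst m σ s CA L) * 2

lemma remainderConst_nonneg {m σ s CA L : ℝ} (hm : 0 ≤ m) (hσ : 0 ≤ σ) (hσ1 : σ < 1) (hs : 0 ≤ s)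
    (hs1 : s < 1) (hCA : 0 ≤ CA) (hL : 0 ≤ L) : 0 ≤ remainderConst m σ s CA L := by
  have h1 : 0 < 1 - σ := by linarith
  have h2 : 0 < 1 - s := by linarith
  unfold remainderConst aprioriConst crossConst offsetConst
  positivity

/-- Two estimates of the Newton correction `D` combined. The second is coercive without remainder,
but with the worse constant `1 - s`; it only shows that `D` is of second order in the previous
corrections `A, B`. The first has the sharp constant `1 - σ` and a remainder `m h D`, which thereby
becomes of fourth order. Here `c, c'` are the norms of the Picard residuals, `W` that of their
Anderson combination, `h = ‖∇(û - ũ)‖`, and `T` collects the terms with differences of iterates. -/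
lemma correction_le_of_two_estimates {m σ s CA L β D A B c c' W h T : ℝ} (hm : 0 ≤ m)
    (hσ : 0 ≤ σ) (hσ1 : σ < 1) (hs : 0 ≤ s) (hs1 : s < 1) (hCA : 0 ≤ CA) (hL : 0 ≤ L)
    (hD : 0 ≤ D) (hW : 0 ≤ W) (hc0 : 0 ≤ c) (hc0' : 0 ≤ c')
    (hc : c ≤ m * A ^ 2) (hc' : c' ≤ m * B ^ 2) (hWc : W ≤ c) (hhc : h ≤ offsetConst σ * c)
    (hmc : m * c ≤ (1 + L) * σ) (hmc' : m * c' ≤ (1 + L) * σ)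
    (hT : T ≤ m * crossConst σ CA * (c * (c + c')))
    (h1 : (1 - σ) * D ≤
      T + β * σ * W + m * W * h + m * (1 - β) * CA * (A ^ 2 + B ^ 2) + m * h * D)
    (h2 : (1 - s) * D ≤ T + s * W + m * CA * (A ^ 2 + B ^ 2)) :
    D ≤ (1 - σ)⁻¹ * (β * σ * W + (1 - β) * (m * CA * (A ^ 2 + B ^ 2))) +
      remainderConst m σ s CA L * (A ^ 4 + B ^ 4) := by
  have p1 : 0 < 1 - σ := by linarith
  have p2 : 0 < 1 - s := by linarith
  have hτ : 0 ≤ crossConst σ CA := by unfold crossConst; positivity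
  have hκ : 0 ≤ offsetConst σ := by unfold offsetConst; positivity
  have hκ₂ : 0 ≤ aprioriConst m σ s CA L := by unfold aprioriConst; positivity
  set S := A ^ 2 + B ^ 2 with hS
  have hcS : c ≤ m * S := hc.trans (by rw [hS]; gcongr; linarith [sq_nonneg B])
  have hccS : c + c' ≤ m * S := by rw [hS]; linarith
  have hS0 : 0 ≤ S := by positivity
  -- Here `T` is linear in `c`, because `m (c + c')` is bounded by `hmc` and `hmc'`.
  have hD2 : D ≤ aprioriConst m σ s CA L * S := by
    have e1 : T ≤ crossConst σ CA * (2 * ((1 + L) * σ)) * (m * S) := by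
      refine hT.trans ?_
      calc m * crossConst σ CA * (c * (c + c')) = crossConst σ CA * (m * c + m * c') * c := by ring
        _ ≤ crossConst σ CA * (2 * ((1 + L) * σ)) * (m * S) := by
          gcongr
          linarith
    have e2 : s * W ≤ s * (m * S) := by
      gcongr
      exact hWc.trans hcS
    rw [aprioriConst, mul_assoc, inv_mul_eq_div, le_div_iff₀ p2]
    linarith
  have hcSA : c * (c + c') ≤ m * A ^ 2 * (m * S) := by gcongr
  have hcc : c * c ≤ m * A ^ 2 * (m * S) := by gcongr
  have f1 : T ≤ crossConst σ CA * m ^ 3 * (A ^ 2 * S) := by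
    refine hT.trans ?_
    calc m * crossConst σ CA * (c * (c + c')) ≤ m * crossConst σ CA * (m * A ^ 2 * (m * S)) := by
          gcongr
      _ = _ := by ring
  have f2 : m * W * h ≤ offsetConst σ * m ^ 3 * (A ^ 2 * S) := by
    calc m * W * h ≤ m * W * (offsetConst σ * c) := by gcongr
      _ ≤ m * c * (offsetConst σ * c) := by gcongr
      _ = m * offsetConst σ * (c * c) := by ring
      _ ≤ m * offsetConst σ * (m * A ^ 2 * (m * S)) := by gcongr
      _ = _ := by ring
  have f3 : m * h * D ≤ m ^ 2 * offsetConst σ * aprioriConst m σ s CA L * (A ^ 2 * S) := by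
    calc m * h * D ≤ m * (offsetConst σ * c) * D := by gcongr
      _ ≤ m * (offsetConst σ * (m * A ^ 2)) * (aprioriConst m σ s CA L * S) := by gcongr
      _ = _ := by ring
  have f4 : A ^ 2 * S ≤ 2 * (A ^ 4 + B ^ 4) := by
    rw [hS]
    nlinarith [sq_nonneg (A ^ 2 - B ^ 2), sq_nonneg (B ^ 2), sq_nonneg (A ^ 2)]
  have hsum : 0 ≤ crossConst σ CA * m ^ 3 + offsetConst σ * m ^ 3
    + m ^ 2 * offsetConst σ * aprioriConst m σ s CA L := by positivity
  have f5 := mul_le_mul_of_nonneg_left f4 hsum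
  have f6 : (1 - σ)⁻¹ * (β * σ * W + (1 - β) * (m * CA * S)) +
      remainderConst m σ s CA L * (A ^ 4 + B ^ 4) =
      (1 - σ)⁻¹ * (β * σ * W + (1 - β) * (m * CA * S) + (crossConst σ CA * m ^ 3 +
        offsetConst σ * m ^ 3 + m ^ 2 * offsetConst σ * aprioriConst m σ s CA L) *
          (2 * (A ^ 4 + B ^ 4))) := by
    rw [remainderConst]
    ring
  rw [f6, inv_mul_eq_div, le_div_iff₀ p1]
  linarith

section Abstract

variable {E H : Type*} [AddCommGroup E] [Module ℝ E] [NormedAddCommGroup H]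
  [InnerProductSpace ℝ H]
  {G : E →ₗ[ℝ] H} {b : E →ₗ[ℝ] E →ₗ[ℝ] E →ₗ[ℝ] ℝ} {M ν F σ s CA L : ℝ} {f : E →ₗ[ℝ] ℝ}
  {V : Submodule ℝ E}

/-- The Newton correction in terms of the Anderson combination and the two previous corrections, up
to a fourth order remainder. In the convective terms containing `û`, replacing `û` by the Picard
iterate `p`, whose norm is at most `ν⁻¹ F`, yields the constant `σ`; the error `û - p` is of the
size of the Picard residual. -/
lemma norm_defect_le (hb : IsConvection G b M) (hν : 0 < ν) (hM : 0 < M) (hF : 0 ≤ F)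
    (hf : ∀ v, |f v| ≤ F * ‖G v‖) (hσ : M * ν⁻¹ ^ 2 * F = σ) (hσ1 : σ < 1) (hs1 : s < 1)
    (hL : 0 ≤ L) {x y z zh p q δx δy w w' : E} {a β : ℝ} (hβ : 0 ≤ β) (hβ1 : β ≤ 1)
    (ha : |1 - a| + |a| ≤ CA)
    (hx : IsSolutionWithDefect ν G b f V x δx) (hy : IsSolutionWithDefect ν G b f V y δy)
    (hz : IsSolutionWithDefect ν G b f V z (z - zh))
    (hp : IsPicardStep ν G b f V x p) (hq : IsPicardStep ν G b f V y q)
    (hw : w = p - x) (hw' : w' = q - y)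
    (hzh : zh = β • ((1 - a) • p + a • q) + (1 - β) • ((1 - a) • x + a • y))
    (hmin : ∀ t : ℝ, ‖G ((1 - a) • w + a • w')‖ ≤ ‖G ((1 - t) • w + t • w')‖)
    (hxL : ‖G x‖ ≤ L * ν⁻¹ * F) (hyL : ‖G y‖ ≤ L * ν⁻¹ * F)
    (hhat : M * ‖G zh‖ ≤ ν * s) :
    ‖G (z - zh)‖ ≤ (1 - σ)⁻¹ * (β * σ * ‖G ((1 - a) • w + a • w')‖ +
        (1 - β) * (ν⁻¹ * M * CA * (‖G δx‖ ^ 2 + ‖G δy‖ ^ 2))) +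
      remainderConst (ν⁻¹ * M) σ s CA L * (‖G δx‖ ^ 4 + ‖G δy‖ ^ 4) := by
  obtain ⟨δ, rfl⟩ : ∃ δ, zh = z - δ := ⟨z - zh, (sub_sub_cancel _ _).symm⟩
  rw [sub_sub_cancel] at hz ⊢
  have p1 : 0 < 1 - σ := by linarith
  have hσ0 : 0 ≤ σ := by rw [← hσ]; positivity
  have hs0 : 0 ≤ s := by
    have : 0 ≤ ν * s := le_trans (by positivity) hhat
    exact nonneg_of_mul_nonneg_right this hν
  have hCA0 : 0 ≤ CA := le_trans (by positivity) ha
  have ha1 : |1 - a| ≤ CA := by linarith [abs_nonneg a]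
  have ha2 : |a| ≤ CA := by linarith [abs_nonneg (1 - a)]
  have hβ' : 0 ≤ 1 - β := by linarith
  have hself := hb.self (z - δ) δ
  have heq := error_equation hx hy hz hp hq hw hw' hzh hz.2.1
  set W := (1 - a) • w + a • w' with hWdef
  have hc := hp.norm_sub_le_sq hb hν hM hx
  have hc' := hq.norm_sub_le_sq hb hν hM hy
  rw [← hw] at hc
  rw [← hw'] at hc'
  have hpn := hp.norm_le hb hν hF hf
  have hqn := hq.norm_le hb hν hF hf
  have hWc : ‖G W‖ ≤ ‖G w‖ := by simpa using hmin 0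
  have hae : |a| * ‖G (w - w')‖ ≤ ‖G w‖ := by
    rw [map_sub]
    exact anderson_coeff_mul_norm_le fun t => by simpa [hWdef] using hmin t
  have hE : ‖G (w - w')‖ ≤ ‖G w‖ + ‖G w'‖ := by
    rw [map_sub]; exact norm_sub_le _ _
  -- In `x - y = (p - q) - (w - w')` the contraction absorbs `p - q` on the left.
  have hX : ‖G (x - y)‖ ≤ (1 - σ)⁻¹ * ‖G (w - w')‖ := by
    have h1 := hp.norm_sub_le hb hν hM hF hf hq
    rw [hσ] at h1
    have h2 : x - y = (p - q) - (w - w') := by rw [hw, hw']; abel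
    have h3 : ‖G (x - y)‖ ≤ ‖G (p - q)‖ + ‖G (w - w')‖ := by
      conv_lhs => rw [h2, map_sub]
      exact norm_sub_le _ _
    rw [inv_mul_eq_div, le_div_iff₀ p1]
    linarith
  have haX : |a| * ‖G (x - y)‖ ≤ (1 - σ)⁻¹ * ‖G w‖ := by
    calc |a| * ‖G (x - y)‖ ≤ |a| * ((1 - σ)⁻¹ * ‖G (w - w')‖) := by gcongr
      _ = (1 - σ)⁻¹ * (|a| * ‖G (w - w')‖) := by ring
      _ ≤ _ := by gcongr
  have hoff : ‖G (z - δ - p)‖ ≤ offsetConst σ * ‖G w‖ := by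
    have e : z - δ - p = β • W - w - a • (x - y) := by
      rw [hzh, hWdef, hw, hw']; module
    rw [e, map_sub, map_sub, map_smul, map_smul]
    refine (norm_sub_le _ _).trans ?_
    have := norm_sub_le (β • G W) (G w)
    rw [norm_smul, Real.norm_eq_abs, abs_of_nonneg hβ] at this
    rw [norm_smul, Real.norm_eq_abs, offsetConst]
    have h1 : β * ‖G W‖ ≤ 1 * ‖G w‖ := by gcongr
    linarith
  set T := ν⁻¹ * M * CA * (|a| * ‖G (x - y)‖) * (‖G (x - y)‖ + ‖G (w - w')‖) with hTdef
  have hT : T ≤ ν⁻¹ * M * crossConst σ CA * (‖G w‖ * (‖G w‖ + ‖G w'‖)) := by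
    have e : ‖G (x - y)‖ + ‖G (w - w')‖ ≤ ((1 - σ)⁻¹ + 1) * (‖G w‖ + ‖G w'‖) := by
      calc _ ≤ ((1 - σ)⁻¹ + 1) * ‖G (w - w')‖ := by linarith
        _ ≤ _ := by gcongr
    calc T ≤ ν⁻¹ * M * CA * ((1 - σ)⁻¹ * ‖G w‖) * (((1 - σ)⁻¹ + 1) * (‖G w‖ + ‖G w'‖)) := by
          rw [hTdef]; gcongr
      _ = _ := by rw [crossConst]; ring
  -- In the next two terms the factor `a` goes with `x - y`, where `haX` bounds the product, while
  -- `1 - a` is only bounded by `CA`.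
  have t1 : a * (1 - a) * b (x - y) (x - y) δ ≤
      M * CA * (|a| * ‖G (x - y)‖) * ‖G (x - y)‖ * ‖G δ‖ := by
    refine (le_abs_self _).trans ?_
    rw [abs_mul, abs_mul]
    calc |a| * |1 - a| * |b (x - y) (x - y) δ|
        ≤ |a| * CA * (M * ‖G (x - y)‖ * ‖G (x - y)‖ * ‖G δ‖) := by
          gcongr
          exact hb.bound _ _ _
      _ = _ := by ring
  have t2 : β * (a * (1 - a)) * b (x - y) (w - w') δ ≤
      M * CA * (|a| * ‖G (x - y)‖) * ‖G (w - w')‖ * ‖G δ‖ := by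
    refine (le_abs_self _).trans ?_
    rw [abs_mul, abs_mul, abs_mul, abs_of_nonneg hβ]
    calc β * (|a| * |1 - a|) * |b (x - y) (w - w') δ|
        ≤ 1 * (|a| * CA) * (M * ‖G (x - y)‖ * ‖G (w - w')‖ * ‖G δ‖) := by
          gcongr
          exact hb.bound _ _ _
      _ = _ := by ring
  have t4 : -((1 - β) * ((1 - a) * b δx δx δ + a * b δy δy δ)) ≤
      M * (1 - β) * CA * (‖G δx‖ ^ 2 + ‖G δy‖ ^ 2) * ‖G δ‖ := by
    have g1 : -((1 - a) * b δx δx δ) ≤ CA * (M * ‖G δx‖ * ‖G δx‖ * ‖G δ‖) := by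
      refine (neg_le_abs _).trans ?_
      rw [abs_mul]
      gcongr
      exact hb.bound _ _ _
    have g2 : -(a * b δy δy δ) ≤ CA * (M * ‖G δy‖ * ‖G δy‖ * ‖G δ‖) := by
      refine (neg_le_abs _).trans ?_
      rw [abs_mul]
      gcongr
      exact hb.bound _ _ _
    calc _ = (1 - β) * (-((1 - a) * b δx δx δ) + -(a * b δy δy δ)) := by ring
      _ ≤ (1 - β) * (CA * (M * ‖G δx‖ * ‖G δx‖ * ‖G δ‖) + CA * (M * ‖G δy‖ * ‖G δy‖ * ‖G δ‖)) := by
        gcongr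
      _ = _ := by ring
  have hMp : M * ‖G p‖ ≤ ν * σ := by
    calc M * ‖G p‖ ≤ M * (ν⁻¹ * F) := by gcongr
      _ = ν * (M * ν⁻¹ ^ 2 * F) := by field_simp
      _ = _ := by rw [hσ]
  have hsplit : z - δ = p + (z - δ - p) := by abel
  rw [hself, real_inner_self_eq_norm_sq] at heq
  have scale : ∀ k R : ℝ, 0 ≤ R → ν * k * ‖G δ‖ ^ 2 ≤ ν * R * ‖G δ‖ → k * ‖G δ‖ ≤ R := by
    intro k R hR h
    refine le_of_mul_le_mul_left ?_ hν
    rw [← mul_assoc]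
    exact le_of_mul_self_le (norm_nonneg _) (by positivity) h
  have hTν : ν * T = M * CA * (|a| * ‖G (x - y)‖) * (‖G (x - y)‖ + ‖G (w - w')‖) := by
    rw [hTdef]; field_simp
  have hνM : ν * (ν⁻¹ * M) = M := by field_simp
  have hT0 : 0 ≤ T := by positivity
  have hmw : ∀ {u r : E}, ‖G r‖ ≤ ν⁻¹ * F → ‖G u‖ ≤ L * ν⁻¹ * F →
      ν⁻¹ * M * ‖G (r - u)‖ ≤ (1 + L) * σ := by
    intro u r hr hu
    have h1 : ‖G (r - u)‖ ≤ ν⁻¹ * F + L * ν⁻¹ * F := by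
      rw [map_sub]
      exact (norm_sub_le _ _).trans (add_le_add hr hu)
    calc ν⁻¹ * M * ‖G (r - u)‖ ≤ ν⁻¹ * M * (ν⁻¹ * F + L * ν⁻¹ * F) := by gcongr
      _ = (1 + L) * (M * ν⁻¹ ^ 2 * F) := by ring
      _ = _ := by rw [hσ]
  refine correction_le_of_two_estimates (m := ν⁻¹ * M) (h := ‖G (z - δ - p)‖) (T := T)
    (by positivity) hσ0 hσ1 hs0 hs1 hCA0 hL (norm_nonneg _) (norm_nonneg _) (norm_nonneg (G w)) (norm_nonneg (G w')) hc hc' hWc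
    hoff (hw ▸ hmw hpn hxL) (hw' ▸ hmw hqn hyL) hT ?_ ?_
  · refine scale _ _ (by positivity) ?_
    have q1 : -b δ (z - δ) δ ≤ (ν * σ + M * ‖G (z - δ - p)‖) * ‖G δ‖ ^ 2 := by
      have r1 := hb.neg_le δ p δ
      have r2 := hb.neg_le δ (z - δ - p) δ
      have r3 : b δ (z - δ) δ = b δ p δ + b δ (z - δ - p) δ := by
        conv_lhs => rw [hsplit, map_add, LinearMap.add_apply]
      have r4 : M * ‖G p‖ * ‖G δ‖ ^ 2 ≤ ν * σ * ‖G δ‖ ^ 2 := by gcongr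
      rw [r3]
      linarith
    have q2 : -(β * b W (z - δ) δ) ≤
        (ν * (β * σ * ‖G W‖) + M * ‖G W‖ * ‖G (z - δ - p)‖) * ‖G δ‖ := by
      have r1 := hb.neg_le W p δ
      have r2 := hb.neg_le W (z - δ - p) δ
      have r3 : b W (z - δ) δ = b W p δ + b W (z - δ - p) δ := by
        conv_lhs => rw [hsplit, map_add, LinearMap.add_apply]
      have r4 : M * ‖G W‖ * ‖G p‖ * ‖G δ‖ ≤ ν * σ * ‖G W‖ * ‖G δ‖ := by
        calc M * ‖G W‖ * ‖G p‖ * ‖G δ‖ = M * ‖G p‖ * ‖G W‖ * ‖G δ‖ := by ring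
          _ ≤ _ := by gcongr
      have r5 : β * -b W p δ ≤ β * (ν * σ * ‖G W‖ * ‖G δ‖) := by
        gcongr
        exact r1.trans r4
      have r6 : β * -b W (z - δ - p) δ ≤ 1 * (M * ‖G W‖ * ‖G (z - δ - p)‖ * ‖G δ‖) := by
        calc _ ≤ β * (M * ‖G W‖ * ‖G (z - δ - p)‖ * ‖G δ‖) := by gcongr
          _ ≤ _ := by gcongr
      rw [r3]
      linarith
    have expand : ν * (T + β * σ * ‖G W‖ + ν⁻¹ * M * ‖G W‖ * ‖G (z - δ - p)‖ +
        ν⁻¹ * M * (1 - β) * CA * (‖G δx‖ ^ 2 + ‖G δy‖ ^ 2) + ν⁻¹ * M * ‖G (z - δ - p)‖ * ‖G δ‖) =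
        ν * T + ν * (β * σ * ‖G W‖) + M * ‖G W‖ * ‖G (z - δ - p)‖ +
        M * (1 - β) * CA * (‖G δx‖ ^ 2 + ‖G δy‖ ^ 2) + M * ‖G (z - δ - p)‖ * ‖G δ‖ := by
      field_simp
    rw [expand, hTν]
    linarith
  · refine scale _ _ (by positivity) ?_
    have q1 : -b δ (z - δ) δ ≤ ν * s * ‖G δ‖ ^ 2 := by
      have r1 := hb.neg_le δ (z - δ) δ
      have r2 : M * ‖G (z - δ)‖ * ‖G δ‖ ^ 2 ≤ ν * s * ‖G δ‖ ^ 2 := by gcongr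
      linarith
    have q2 : -(β * b W (z - δ) δ) ≤ ν * s * ‖G W‖ * ‖G δ‖ := by
      have r1 := hb.bound W (z - δ) δ
      have r2 : M * ‖G W‖ * ‖G (z - δ)‖ * ‖G δ‖ ≤ ν * s * ‖G W‖ * ‖G δ‖ := by
        calc _ = M * ‖G (z - δ)‖ * ‖G W‖ * ‖G δ‖ := by ring
          _ ≤ _ := by gcongr
      have r3 : β * |b W (z - δ) δ| ≤ 1 * |b W (z - δ) δ| := by gcongr
      have r4 := mul_le_mul_of_nonneg_left (neg_le_abs (b W (z - δ) δ)) hβ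
      linarith
    have t4' : M * (1 - β) * CA * (‖G δx‖ ^ 2 + ‖G δy‖ ^ 2) * ‖G δ‖ ≤
        M * 1 * CA * (‖G δx‖ ^ 2 + ‖G δy‖ ^ 2) * ‖G δ‖ := by
      gcongr
      linarith
    have expand : ν * (T + s * ‖G W‖ + ν⁻¹ * M * CA * (‖G δx‖ ^ 2 + ‖G δy‖ ^ 2)) =
        ν * T + ν * s * ‖G W‖ + M * CA * (‖G δx‖ ^ 2 + ‖G δy‖ ^ 2) := by
      field_simp
    rw [expand, hTν]
    linarith

end Abstract

/-! ### Ratios of residuals and corrections -/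

lemma exists_ratio {r D S T : ℝ} (hr : 0 ≤ r) (hD : 0 ≤ D) (hS : 1 ≤ S) (hT : 1 ≤ T)
    (hupper : r ^ 2 ≤ T * D ^ 2) (hlower : D ^ 2 ≤ S * r ^ 2) :
    ∃ c : ℝ, 0 < c ∧ r = c * D ∧ S⁻¹ ≤ c ^ 2 ∧ c ^ 2 ≤ T := by
  rcases hD.eq_or_lt with rfl | hD
  -- If `D = 0`, then `r = 0` too, and any number between the bounds will do.
  · refine ⟨1, one_pos, ?_, by simpa using inv_le_one_of_one_le₀ hS, by simpa using hT⟩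
    have : r ^ 2 = 0 := le_antisymm (by simpa using hupper) (sq_nonneg r)
    simpa using this
  · have hr : 0 < r := by
      refine hr.lt_of_ne fun h => ?_
      rw [← h] at hlower
      nlinarith [pow_pos hD 2]
    refine ⟨r / D, div_pos hr hD, by field_simp, ?_, ?_⟩
    · rw [div_pow, le_div_iff₀ (by positivity), inv_mul_eq_div, div_le_iff₀ (by positivity)]
      linarith
    · rwa [div_pow, div_le_iff₀ (by positivity)]

lemma pow_add_pow_le_higherOrder {r : ℕ → ℝ} {s : ℝ} (hr : ∀ j, 0 ≤ r j) (hs : 0 ≤ s) (n : ℕ) :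
    r (n + 3) ^ 4 + r (n + 2) ^ 4 ≤ higherOrder r s (n + 3) := by
  have h := Finset.single_le_sum (f := fun j => r j ^ 2 ^ (n + 3 - j + 1))
    (fun j _ => pow_nonneg (hr j) _) (show n + 2 ∈ Finset.Icc 2 (n + 3 - 1) by simp)
  have e : n + 3 - (n + 2) + 1 = 2 := by omega
  simp only [e] at h
  have h2 : 0 ≤ s ^ 2 ^ (n + 2) := pow_nonneg hs _
  unfold higherOrder
  norm_num at h ⊢
  linarith

/-- Conversion of a bound for the Newton correction `D` in terms of the previous corrections `A, B`
into one for the residuals `r₃ = c₃ D`, `r₂ = c₂ A`, `r₁ = c₁ B`. -/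
lemma residual_bound_of_defect_bound {ν M σ T S K₀ CA β θ A B D w c₁ c₂ c₃ r₁ r₂ r₃ h : ℝ}
    (hν : 0 < ν) (hM : 0 < M) (hσ : 0 ≤ σ) (hσ1 : σ < 1) (hT : 1 ≤ T) (hS : 1 ≤ S) (hK₀ : 0 ≤ K₀)
    (hβ : 0 ≤ β) (hθ : 0 ≤ θ) (hc₁ : 0 < c₁) (hc₂ : 0 < c₂) (hc₃ : 0 < c₃)
    (hr₁ : r₁ = c₁ * B) (hr₂ : r₂ = c₂ * A) (hr₃ : r₃ = c₃ * D)
    (hl₁ : S⁻¹ ≤ c₁ ^ 2) (hl₂ : S⁻¹ ≤ c₂ ^ 2) (hu₃ : c₃ ^ 2 ≤ T) (hw : w ≤ ν⁻¹ * M * A ^ 2)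
    (hD : D ≤ (1 - σ)⁻¹ * (β * σ * (θ * w) + (1 - β) * (ν⁻¹ * M * CA * (A ^ 2 + B ^ 2))) +
      K₀ * (A ^ 4 + B ^ 4))
    (hh : r₂ ^ 4 + r₁ ^ 4 ≤ h) :
    r₃ ≤ ν⁻¹ * M * c₂⁻¹ ^ 2 * c₃ / (1 - σ) * (θ * β * σ + (1 - β) * CA) * r₂ ^ 2
      + (1 - β) * (CA * ν⁻¹ * M * c₁⁻¹ ^ 2 * c₃ / (1 - σ)) * r₁ ^ 2 + T * K₀ * S ^ 2 * h := by
  subst hr₁ hr₂ hr₃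
  have p1 : 0 < 1 - σ := by linarith
  have four : ∀ c t : ℝ, S⁻¹ ≤ c ^ 2 → t ^ 4 ≤ S ^ 2 * (c * t) ^ 4 := by
    intro c t hl
    have h1 : 1 ≤ S * c ^ 2 := by
      rwa [inv_eq_one_div, div_le_iff₀ (by linarith), mul_comm] at hl
    calc t ^ 4 = 1 ^ 2 * t ^ 4 := by ring
      _ ≤ (S * c ^ 2) ^ 2 * t ^ 4 := by gcongr
      _ = _ := by ring
  have hc₃T : c₃ ≤ T := by
    by_contra! hlt
    nlinarith
  have hrem : c₃ * (K₀ * (A ^ 4 + B ^ 4)) ≤ T * K₀ * S ^ 2 * h := by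
    have h1 := four _ A hl₂
    have h2 := four _ B hl₁
    calc c₃ * (K₀ * (A ^ 4 + B ^ 4))
        ≤ T * (K₀ * (S ^ 2 * (c₂ * A) ^ 4 + S ^ 2 * (c₁ * B) ^ 4)) := by gcongr
      _ = T * K₀ * S ^ 2 * ((c₂ * A) ^ 4 + (c₁ * B) ^ 4) := by ring
      _ ≤ _ := by gcongr
  have hquad : c₃ * ((1 - σ)⁻¹ * (β * σ * (θ * w) + (1 - β) * (ν⁻¹ * M * CA * (A ^ 2 + B ^ 2)))) ≤
      ν⁻¹ * M * c₂⁻¹ ^ 2 * c₃ / (1 - σ) * (θ * β * σ + (1 - β) * CA) * (c₂ * A) ^ 2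
        + (1 - β) * (CA * ν⁻¹ * M * c₁⁻¹ ^ 2 * c₃ / (1 - σ)) * (c₁ * B) ^ 2 := by
    calc _ ≤ c₃ * ((1 - σ)⁻¹ * (β * σ * (θ * (ν⁻¹ * M * A ^ 2)) +
          (1 - β) * (ν⁻¹ * M * CA * (A ^ 2 + B ^ 2)))) := by gcongr
      _ = _ := by
        field_simp
        ring
  refine (mul_le_mul_of_nonneg_left hD hc₃.le).trans ?_
  rw [mul_add]
  exact add_le_add hquad hrem

/-! ### The iteration on `X` -/

section

variable {d : ℕ} {Ω : Set (Vec d)}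

/-- The weak gradient as a linear map on `X`. -/
def gradHom (Ω : Set (Vec d)) : X Ω →ₗ[ℝ] L2Mat Ω where
  toFun := grad
  map_add' _ _ := rfl
  map_smul' _ _ := rfl

lemma gradNorm_nonneg (v : X Ω) : 0 ≤ gradNorm v := norm_nonneg _

lemma isConvection_bstarHom {C : ℝ≥0} (hC : IsSobolevBound Ω C) {M : ℝ}
    (hM : IsTrilinearBound Ω M) : IsConvection (gradHom Ω) (bstarHom hC) M where
  self := bstar_self hC
  bound v w z := by
    refine abs_le'.2 ⟨hM v w z, ?_⟩
    have h := hM v w (-z)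
    have e1 : bstar v w (-z) = -bstar v w z := map_neg (bstarHom hC v w) z
    have e2 : gradNorm (-z) = gradNorm z := norm_neg (grad z)
    rwa [e1, e2] at h

lemma exists_isTrilinearBound (hd : d = 2 ∨ d = 3) (hΩ : Bornology.IsBounded Ω) :
    ∃ M : ℝ, 0 < M ∧ IsTrilinearBound Ω M := by
  obtain ⟨C, hC⟩ := exists_isSobolevBound hd hΩ
  refine ⟨3 / 2 * d ^ 2 * C ^ 2 + 1, by positivity, fun v w z => ?_⟩
  refine ((le_abs_self _).trans (abs_bstar_le hC v w z)).trans ?_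
  have h1 := gradNorm_nonneg v
  have h2 := gradNorm_nonneg w
  have h3 := gradNorm_nonneg z
  gcongr
  linarith

variable {ν : ℝ} {f : X Ω →L[ℝ] ℝ} {β α : ℕ → ℝ} {ut uh u : ℕ → X Ω}

namespace IsAAPicardNewton

lemma mem (h : IsAAPicardNewton ν f β α ut uh u) : ∀ k, u k ∈ V Ω
  | 0 => h.initial
  | k + 1 => h.newton_mem k

lemma hat_mem (h : IsAAPicardNewton ν f β α ut uh u) (k : ℕ) : uh (k + 1) ∈ V Ω := by
  rcases k with _ | k
  · rw [zero_add, h.anderson_first]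
    exact (V Ω).add_mem ((V Ω).smul_mem _ (h.picard_mem 0)) ((V Ω).smul_mem _ h.initial)
  · rw [h.anderson (k + 1 + 1) (by omega)]
    exact (V Ω).add_mem ((V Ω).smul_mem _ ((V Ω).add_mem ((V Ω).smul_mem _ (h.picard_mem (k + 1)))
      ((V Ω).smul_mem _ (h.picard_mem k)))) ((V Ω).smul_mem _ ((V Ω).add_mem
      ((V Ω).smul_mem _ (h.mem (k + 1))) ((V Ω).smul_mem _ (h.mem k))))

lemma isPicardStep (h : IsAAPicardNewton ν f β α ut uh u) {C : ℝ≥0} (hC : IsSobolevBound Ω C)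
    (k : ℕ) : IsPicardStep ν (gradHom Ω) (bstarHom hC) f (V Ω) (u k) (ut (k + 1)) :=
  ⟨h.picard_mem k, h.picard k⟩

lemma isSolutionWithDefect (h : IsAAPicardNewton ν f β α ut uh u) {C : ℝ≥0}
    (hC : IsSobolevBound Ω C) (k : ℕ) : IsSolutionWithDefect ν (gradHom Ω) (bstarHom hC) f (V Ω)
      (u (k + 1)) (u (k + 1) - uh (k + 1)) := by
  refine ⟨h.newton_mem k, (V Ω).sub_mem (h.newton_mem k) (h.hat_mem k), fun v hv => ?_⟩
  have e : ν * inner ℝ (gradHom Ω (u (k + 1))) (gradHom Ω v) +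
      bstarHom hC (uh (k + 1)) (u (k + 1)) v + bstarHom hC (u (k + 1)) (uh (k + 1)) v -
      bstarHom hC (uh (k + 1)) (uh (k + 1)) v = f v := h.newton k v hv
  simp only [map_sub, LinearMap.sub_apply] at *
  change _ = f v
  linear_combination e

lemma gradNorm_hat_le (h : IsAAPicardNewton ν f β α ut uh u) {CA B : ℝ} (hB : 0 ≤ B)
    (hα : ∀ k, 2 ≤ k → |1 - α k| + |α k| ≤ CA)
    (hut : ∀ k, gradNorm (ut (k + 1)) ≤ B) (hu : ∀ k, gradNorm (u k) ≤ B) (k : ℕ) :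
    gradNorm (uh (k + 1)) ≤ CA * B := by
  have hCA : 1 ≤ CA := by
    have h1 := hα 2 le_rfl
    have h2 := abs_add_le (1 - α 2) (α 2)
    rw [sub_add_cancel, abs_one] at h2
    linarith
  have hcomb : ∀ (s t R : ℝ) (v w : X Ω), gradNorm v ≤ R → gradNorm w ≤ R →
      gradNorm (s • v + t • w) ≤ (|s| + |t|) * R := by
    intro s t R v w hv hw
    calc gradNorm (s • v + t • w) ≤ |s| * gradNorm v + |t| * gradNorm w := by
          refine (norm_add_le (s • grad v) (t • grad w)).trans_eq ?_
          rw [norm_smul, norm_smul]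
          rfl
      _ ≤ |s| * R + |t| * R := by gcongr
      _ = _ := by ring
  have hβ : ∀ k, |β (k + 1)| + |1 - β (k + 1)| = 1 := by
    intro k
    obtain ⟨h1, h2⟩ := h.damping (k + 1) (by omega)
    rw [abs_of_pos h1, abs_of_nonneg (by linarith)]
    ring
  rcases k with _ | k
  · rw [zero_add, h.anderson_first]
    have := hcomb (β 1) (1 - β 1) B _ _ (hut 0) (hu 0)
    rw [hβ 0] at this
    nlinarith
  · rw [h.anderson (k + 1 + 1) (by omega)]
    have e := hα (k + 1 + 1) (by omega)
    have e1 : gradNorm ((1 - α (k + 1 + 1)) • ut (k + 1 + 1) + α (k + 1 + 1) • ut (k + 1)) ≤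
        CA * B :=
      (hcomb _ _ B _ _ (hut (k + 1)) (hut k)).trans (mul_le_mul_of_nonneg_right e hB)
    have e2 : gradNorm ((1 - α (k + 1 + 1)) • u (k + 1) + α (k + 1 + 1) • u k) ≤ CA * B :=
      (hcomb _ _ B _ _ (hu (k + 1)) (hu k)).trans (mul_le_mul_of_nonneg_right e hB)
    have := hcomb (β (k + 1 + 1)) (1 - β (k + 1 + 1)) _ _ _ e1 e2
    exact this.trans_eq ((congrArg (· * (CA * B)) (hβ (k + 1))).trans (one_mul _))

lemma gradNorm_andersonComb (h : IsAAPicardNewton ν f β α ut uh u) {k : ℕ} (hk : 2 ≤ k) :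
    gradNorm (andersonComb ut u k (α k)) =
      andersonGain α ut u k * gradNorm (ut k - u (k - 1)) := by
  rcases (gradNorm_nonneg (ut k - u (k - 1))).eq_or_lt with h0 | h0
  · have h1 := h.minimizer k hk 0
    have e : andersonComb ut u k 0 = ut k - u (k - 1) := by simp [andersonComb]
    rw [e, ← h0] at h1
    rw [← h0, mul_zero]
    exact le_antisymm h1 (gradNorm_nonneg _)
  · rw [andersonGain, div_mul_cancel₀ _ h0.ne']

lemma mul_gradNorm_hat_le (h : IsAAPicardNewton ν f β α ut uh u) {C : ℝ≥0}
    (hC : IsSobolevBound Ω C) [IsFiniteMeasure (volume.restrict Ω)] {M σ CA L : ℝ} (hν : 0 < ν)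
    (hM : 0 < M) (hMb : IsTrilinearBound Ω M) (hσ : M * ν⁻¹ ^ 2 * dualNorm f = σ)
    (hα : ∀ k, 2 ≤ k → |1 - α k| + |α k| ≤ CA)
    (hu : ∀ k, gradNorm (u k) ≤ L * ν⁻¹ * dualNorm f) (k : ℕ) :
    M * gradNorm (uh (k + 1)) ≤ ν * (σ * CA * max 1 L) := by
  have hF := dualNorm_nonneg f
  have hB : 0 ≤ ν⁻¹ * dualNorm f := by positivity
  have hut : ∀ k, gradNorm (ut (k + 1)) ≤ max 1 L * (ν⁻¹ * dualNorm f) := fun k =>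
    ((h.isPicardStep hC k).norm_le (isConvection_bstarHom hC hMb) hν hF
      (abs_apply_le_dualNorm hC f)).trans (le_mul_of_one_le_left hB (le_max_left _ _))
  have hu' : ∀ k, gradNorm (u k) ≤ max 1 L * (ν⁻¹ * dualNorm f) := fun k =>
    (hu k).trans ((mul_assoc _ _ _).trans_le (mul_le_mul_of_nonneg_right (le_max_right _ _) hB))
  have hle := h.gradNorm_hat_le (by positivity) hα hut hu' k
  calc M * gradNorm (uh (k + 1)) ≤ M * (CA * (max 1 L * (ν⁻¹ * dualNorm f))) :=
        mul_le_mul_of_nonneg_left hle hM.le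
    _ = ν * (M * ν⁻¹ ^ 2 * dualNorm f * CA * max 1 L) := by field_simp
    _ = _ := by rw [hσ]

lemma exists_resid_eq_mul (h : IsAAPicardNewton ν f β α ut uh u) {C : ℝ≥0}
    (hC : IsSobolevBound Ω C) {M σ L s : ℝ} (hν : 0 < ν) (hM : 0 < M)
    (hMb : IsTrilinearBound Ω M) (hσ : M * ν⁻¹ ^ 2 * dualNorm f = σ) (hs0 : 0 ≤ s) (hs1 : s < 1)
    (hhat : ∀ k, M * gradNorm (uh (k + 1)) ≤ ν * s)
    (hu : ∀ k, gradNorm (u k) ≤ L * ν⁻¹ * dualNorm f) (k : ℕ) :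
    ∃ c : ℝ, 0 < c ∧ resid ut uh (k + 1 + 1) = c * gradNorm (u (k + 1) - uh (k + 1)) ∧
      (2 + 4 * σ ^ 2 * L ^ 2)⁻¹ ≤ c ^ 2 ∧ c ^ 2 ≤ (1 - s)⁻¹ := by
  have hb := isConvection_bstarHom hC hMb
  have hp := h.isPicardStep hC (k + 1)
  have hd := h.isSolutionWithDefect hC k
  have h1 := hp.resid_sq_le hb hν hM hs1 hd (hhat k)
  have hul : M * gradNorm (u (k + 1)) ≤ ν * (σ * L) := by
    calc M * gradNorm (u (k + 1)) ≤ M * (L * ν⁻¹ * dualNorm f) :=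
          mul_le_mul_of_nonneg_left (hu _) hM.le
      _ = ν * (M * ν⁻¹ ^ 2 * dualNorm f * L) := by field_simp
      _ = _ := by rw [hσ]
  have h2 := hp.norm_defect_sq_le hb hν hM hd hul
  rw [mul_pow, ← mul_assoc] at h2
  exact exists_ratio (norm_nonneg _) (norm_nonneg _)
    (by linarith [show 0 ≤ 4 * σ ^ 2 * L ^ 2 by positivity])
    ((one_le_inv₀ (by linarith)).2 (by linarith)) h1 h2

lemma gradNorm_newton_correction_le (h : IsAAPicardNewton ν f β α ut uh u) {C : ℝ≥0}
    (hC : IsSobolevBound Ω C) [IsFiniteMeasure (volume.restrict Ω)] {M σ CA L s : ℝ} (hν : 0 < ν)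
    (hM : 0 < M) (hMb : IsTrilinearBound Ω M) (hσ : M * ν⁻¹ ^ 2 * dualNorm f = σ) (hσ1 : σ < 1)
    (hs1 : s < 1) (hL : 0 ≤ L) (hα : ∀ k, 2 ≤ k → |1 - α k| + |α k| ≤ CA)
    (hhat : ∀ k, M * gradNorm (uh (k + 1)) ≤ ν * s)
    (hu : ∀ k, gradNorm (u k) ≤ L * ν⁻¹ * dualNorm f) (n : ℕ) :
    gradNorm (u (n + 3) - uh (n + 3)) ≤ (1 - σ)⁻¹ * (β (n + 3) * σ *
        (andersonGain α ut u (n + 3) * gradNorm (ut (n + 3) - u (n + 2))) +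
        (1 - β (n + 3)) * (ν⁻¹ * M * CA *
          (gradNorm (u (n + 2) - uh (n + 2)) ^ 2 + gradNorm (u (n + 1) - uh (n + 1)) ^ 2))) +
      remainderConst (ν⁻¹ * M) σ s CA L *
        (gradNorm (u (n + 2) - uh (n + 2)) ^ 4 + gradNorm (u (n + 1) - uh (n + 1)) ^ 4) := by
  obtain ⟨hβ0, hβ1⟩ := h.damping (n + 3) (by omega)
  have gain := h.gradNorm_andersonComb (k := n + 3) (by omega)
  have est := norm_defect_le (isConvection_bstarHom hC hMb) hν hM (dualNorm_nonneg f)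
    (abs_apply_le_dualNorm hC f) hσ hσ1 hs1 hL hβ0.le hβ1
    (hα (n + 3) (by omega)) (h.isSolutionWithDefect hC (n + 1)) (h.isSolutionWithDefect hC n)
    (h.isSolutionWithDefect hC (n + 2)) (h.isPicardStep hC (n + 2)) (h.isPicardStep hC (n + 1))
    rfl rfl (h.anderson (n + 3) (by omega)) (h.minimizer (n + 3) (by omega))
    (hu _) (hu _) (hhat (n + 2))
  exact gain ▸ est

end IsAAPicardNewton

end

end SteadyNSE

end

theorem theorem3p1 (d : ℕ) (hd : d = 2 ∨ d = 3) :
    (∀ Ω : Set (Vec d), IsFlowDomain Ω → ∃ M : ℝ, 0 < M ∧ IsTrilinearBound Ω M) ∧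
    ∀ ν M σ C_A L : ℝ, 0 < ν → 0 < M → 0 < C_A → 0 < L →
      σ < 1 → σ * C_A * max 1 L < 1 →
      ∃ K : ℕ → ℝ,
        ∀ (Ω : Set (Vec d)), IsFlowDomain Ω → IsTrilinearBound Ω M →
        ∀ (f : X Ω →L[ℝ] ℝ), M * ν⁻¹ ^ 2 * dualNorm f = σ →
        ∀ (β α : ℕ → ℝ) (ut uh u : ℕ → X Ω),
          IsAAPicardNewton ν f β α ut uh u →
          (∀ k, 2 ≤ k → |1 - α k| + |α k| ≤ C_A) →
          (∀ k, gradNorm (u k) ≤ L * ν⁻¹ * dualNorm f) →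
          ∃ C : ℕ → ℝ,
            (∀ k, 1 ≤ k → 0 < C k ∧
              resid ut uh (k + 1) = C k * gradNorm (u k - uh k) ∧
              (2 + 4 * σ ^ 2 * L ^ 2)⁻¹ ≤ C k ^ 2 ∧
              C k ^ 2 ≤ (1 - σ * C_A * max 1 L)⁻¹) ∧
            (∀ k, 3 ≤ k → α k ≠ 0 →
              resid ut uh (k + 1) ≤
                ν⁻¹ * M * (C (k - 1))⁻¹ ^ 2 * C k / (1 - σ) *
                    (andersonGain α ut u k * β k * σ + (1 - β k) * C_A) *
                    resid ut uh k ^ 2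
                  + (1 - β k) * (C_A * ν⁻¹ * M * (C (k - 2))⁻¹ ^ 2 * C k / (1 - σ)) *
                    resid ut uh (k - 1) ^ 2
                  + K k * higherOrder (resid ut uh) (gradNorm (u 1 - u 0)) k) ∧
            (∀ k, 3 ≤ k → α k ≠ 0 → β k = 1 →
              resid ut uh (k + 1) ≤
                ν⁻¹ * M * (C (k - 1))⁻¹ ^ 2 * C k / (1 - σ) * (σ * andersonGain α ut u k) *
                    resid ut uh k ^ 2
                  + K k * higherOrder (resid ut uh) (gradNorm (u 1 - u 0)) k) := by
  refine ⟨fun Ω hΩ => exists_isTrilinearBound hd hΩ.isBounded, ?_⟩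
  intro ν M σ C_A L hν hM hCA hL hσ1 hs1
  refine ⟨fun _ => (1 - σ * C_A * max 1 L)⁻¹ *
    remainderConst (ν⁻¹ * M) σ (σ * C_A * max 1 L) C_A L * (2 + 4 * σ ^ 2 * L ^ 2) ^ 2, ?_⟩
  intro Ω hΩ hMb f hσ β α ut uh u h hα hu
  obtain ⟨C₄, hC⟩ := exists_isSobolevBound hd hΩ.isBounded
  have : IsFiniteMeasure (volume.restrict Ω) :=
    isFiniteMeasure_restrict.2 hΩ.isBounded.measure_lt_top.ne
  have hσ0 : 0 ≤ σ := by
    rw [← hσ]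
    exact mul_nonneg (by positivity) (dualNorm_nonneg f)
  have hs0 : 0 ≤ σ * C_A * max 1 L := by positivity
  have hhat := h.mul_gradNorm_hat_le hC hν hM hMb hσ hα hu
  choose C hCk using h.exists_resid_eq_mul hC hν hM hMb hσ hs0 hs1 hhat hu
  have hT : 1 ≤ (1 - σ * C_A * max 1 L)⁻¹ := (one_le_inv₀ (by linarith)).2 (by linarith)
  have hS : 1 ≤ 2 + 4 * σ ^ 2 * L ^ 2 := by
    linarith [show 0 ≤ 4 * σ ^ 2 * L ^ 2 by positivity]
  have hK := remainderConst_nonneg (m := ν⁻¹ * M) (by positivity) hσ0 hσ1 hs0 hs1 hCA.le hL.le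
  have hθ : ∀ k, 0 ≤ andersonGain α ut u k := fun k =>
    div_nonneg (gradNorm_nonneg _) (gradNorm_nonneg _)
  have hw : ∀ n, gradNorm (ut (n + 3) - u (n + 2)) ≤
      ν⁻¹ * M * gradNorm (u (n + 2) - uh (n + 2)) ^ 2 := fun n =>
    (h.isPicardStep hC (n + 2)).norm_sub_le_sq (isConvection_bstarHom hC hMb) hν hM
      (h.isSolutionWithDefect hC (n + 1))
  have hh := pow_add_pow_le_higherOrder (r := resid ut uh) (s := gradNorm (u 1 - u 0))
    (fun j => gradNorm_nonneg _) (gradNorm_nonneg _)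
  have main := fun n : ℕ => residual_bound_of_defect_bound hν hM hσ0 hσ1 hT hS hK
    (h.damping (n + 3) (by omega)).1.le (hθ (n + 3))
    (hCk n).1 (hCk (n + 1)).1 (hCk (n + 2)).1
    (hCk n).2.1 (hCk (n + 1)).2.1 (hCk (n + 2)).2.1
    (hCk n).2.2.1 (hCk (n + 1)).2.2.1 (hCk (n + 2)).2.2.2 (hw n)
    (h.gradNorm_newton_correction_le hC hν hM hMb hσ hσ1 hs1 hL.le hα hhat hu n) (hh n)
  -- The constants were chosen for the steps `k + 1`.
  refine ⟨fun k => C (k - 1), ?_, ?_, ?_⟩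
  · rintro (_ | k) hk
    · omega
    · exact hCk k
  · intro k hk _
    obtain ⟨n, rfl⟩ : ∃ n, k = n + 3 := ⟨k - 3, by omega⟩
    exact main n
  · intro k hk _ hβ
    obtain ⟨n, rfl⟩ : ∃ n, k = n + 3 := ⟨k - 3, by omega⟩
    have key := main n
    rw [hβ] at key
    have e : ∀ P t a b c r : ℝ,
        P * (t * 1 * σ + (1 - 1) * C_A) * a + (1 - 1) * b * c + r = P * (σ * t) * a + r := by
      intros
      ring
    exact key.trans_eq (e _ _ _ _ _ _)
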